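/- There is a randomized Monte Carlo algorithm, namely a single program for a logarithmic-cost random access machine that can toss fair coins, and there are constants $c,d\in\mathbb N$ such that the following holds for all $n,q\in\mathbb N$, every simple undirected graph $G$ on the vertex set $\{0,\dots,n-1\}$ and every linear layout of $G$, that is, every bijection $\pi\colon V(G)\to[n]$. Let $$\mathrm{ctw}=\max_{1\le i<n}\bigl|\bigl\{\{u,v\}\in E(G) : \pi(u)\le i<\pi(v)\bigr\}\bigr|$$ be the cutwidth of $G$ with respect to $\pi$ (read as $0$ if $n\le 1$). On input $(G,\pi,q)$, with $G$ given by its adjacency matrix, $\pi$ by the list of the vertices in layout order, and $q$ as an integer, i.e. with $\lceil\log_2(q+1)\rceil$ bits: 1. for every outcome of the coin tosses the algorithm halts after time at most $c\cdot 2^{\mathrm{ctw}}\cdot\bigl(n+\lceil\log_2(q+1)\rceil+1\bigr)^{d}$, that is, it runs in $\mathcal O^*(2^{\mathrm{ctw}})$ time, where $\mathcal O^*$ suppresses factors polynomial in the input size; 2. if $G$ has no proper $q$-coloring, then the algorithm answers "no" for every outcome of the coin tosses; 3. if $G$ has a proper $q$-coloring, then the algorithm answers "yes" with probability at least $1-2^{-(n+1)}$.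 -/

import Mathlib

/-!
  Randomized random access machines with logarithmic cost, and the cutwidth of a linear layout.
-/

namespace CoinRAM

/-- The arithmetic operations of the machine. `div` is the Euclidean quotient of integers;
a quotient by zero is zero. -/
inductive Op where
  | add
  | sub
  | mul
  | div

/-- The value of an arithmetic operation. -/
def Op.eval : Op → ℤ → ℤ → ℤ
  | .add, a, b => a + b
  | .sub, a, b => a - b
  | .mul, a, b => a * b
  | .div, a, b => a / b

/-- Programs of a randomized random access machine. Natural numbers `x y z` name registers
(a program mentions only finitely many of them); the memory is accessed indirectly, through
addresses held in registers. -/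
inductive Prog where
  /-- do nothing -/
  | skip
  /-- `x := c` -/
  | const (x : ℕ) (c : ℤ)
  /-- `x := y o z` -/
  | arith (o : Op) (x y z : ℕ)
  /-- `x := memory[y]` -/
  | load (x y : ℕ)
  /-- `memory[x] := y` -/
  | store (x y : ℕ)
  /-- `x :=` the next random bit -/
  | flip (x : ℕ)
  /-- first `p₁`, then `p₂` -/
  | seq (p₁ p₂ : Prog)
  /-- if `x > 0` then `p₁` else `p₂` -/
  | cond (x : ℕ) (p₁ p₂ : Prog)
  /-- while `x > 0` do `p` -/
  | loop (x : ℕ) (p : Prog)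

/-- A machine state: the contents of the registers and of the memory cells, and the number of
random bits that have been consumed. -/
structure State where
  reg : ℕ → ℤ
  mem : ℤ → ℤ
  used : ℕ

/-- Write the value `a` into register `x`. -/
def State.setReg (s : State) (x : ℕ) (a : ℤ) : State :=
  { s with reg := Function.update s.reg x a }

/-- Write the value `b` into the memory cell with address `a`. -/
def State.setMem (s : State) (a b : ℤ) : State :=
  { s with mem := Function.update s.mem a b }

/-- The number of binary digits of the absolute value of an integer. -/
def len (a : ℤ) : ℕ := a.natAbs.size

/-- `Exec r p s s' t`: started in state `s`, with `r 0, r 1, r 2, …` as its sequence of random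
bits, the program `p` halts in state `s'` after time `t`. Every instruction and every test is
charged one unit plus the bit lengths of all values and addresses that it handles. -/
inductive Exec (r : ℕ → Bool) : Prog → State → State → ℕ → Prop where
  | skip (s : State) : Exec r .skip s s 1
  | const (s : State) (x : ℕ) (c : ℤ) : Exec r (.const x c) s (s.setReg x c) (1 + len c)
  | arith (s : State) (o : Op) (x y z : ℕ) :
      Exec r (.arith o x y z) s (s.setReg x (o.eval (s.reg y) (s.reg z)))
        (1 + len (s.reg y) + len (s.reg z))
  | load (s : State) (x y : ℕ) :
      Exec r (.load x y) s (s.setReg x (s.mem (s.reg y)))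
        (1 + len (s.reg y) + len (s.mem (s.reg y)))
  | store (s : State) (x y : ℕ) :
      Exec r (.store x y) s (s.setMem (s.reg x) (s.reg y))
        (1 + len (s.reg x) + len (s.reg y))
  | flip (s : State) (x : ℕ) :
      Exec r (.flip x) s
        { s.setReg x (if r s.used then 1 else 0) with used := s.used + 1 } 1
  | seq {p₁ p₂ : Prog} {s₁ s₂ s₃ : State} {t₁ t₂ : ℕ} :
      Exec r p₁ s₁ s₂ t₁ → Exec r p₂ s₂ s₃ t₂ → Exec r (.seq p₁ p₂) s₁ s₃ (t₁ + t₂)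
  | cond_pos {x : ℕ} {p₁ p₂ : Prog} {s s' : State} {t : ℕ} :
      0 < s.reg x → Exec r p₁ s s' t → Exec r (.cond x p₁ p₂) s s' (1 + len (s.reg x) + t)
  | cond_neg {x : ℕ} {p₁ p₂ : Prog} {s s' : State} {t : ℕ} :
      ¬ 0 < s.reg x → Exec r p₂ s s' t → Exec r (.cond x p₁ p₂) s s' (1 + len (s.reg x) + t)
  | loop_pos {x : ℕ} {p : Prog} {s₁ s₂ s₃ : State} {t₁ t₂ : ℕ} :
      0 < s₁.reg x → Exec r p s₁ s₂ t₁ → Exec r (.loop x p) s₂ s₃ t₂ →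
      Exec r (.loop x p) s₁ s₃ (1 + len (s₁.reg x) + t₁ + t₂)
  | loop_neg {x : ℕ} {p : Prog} {s : State} :
      ¬ 0 < s.reg x → Exec r (.loop x p) s s (1 + len (s.reg x))

/-- For a given sequence of random bits, the final state and the running time are unique. -/
theorem Exec.unique {r : ℕ → Bool} {p : Prog} {s s₁ s₂ : State} {t₁ t₂ : ℕ}
    (h₁ : Exec r p s s₁ t₁) (h₂ : Exec r p s s₂ t₂) : s₁ = s₂ ∧ t₁ = t₂ := by
  induction h₁ generalizing s₂ t₂ with
  | skip | const | arith | load | store | flip => cases h₂; exact ⟨rfl, rfl⟩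
  | seq _ _ ih₁ ih₂ =>
    cases h₂ with
    | seq a b =>
      obtain ⟨rfl, rfl⟩ := ih₁ a
      obtain ⟨rfl, rfl⟩ := ih₂ b
      exact ⟨rfl, rfl⟩
  | cond_pos hx _ ih =>
    cases h₂ with
    | cond_pos _ a => obtain ⟨rfl, rfl⟩ := ih a; exact ⟨rfl, rfl⟩
    | cond_neg hn _ => exact absurd hx hn
  | cond_neg hx _ ih =>
    cases h₂ with
    | cond_pos hp _ => exact absurd hp hx
    | cond_neg _ a => obtain ⟨rfl, rfl⟩ := ih a; exact ⟨rfl, rfl⟩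
  | loop_pos hx _ _ ih₁ ih₂ =>
    cases h₂ with
    | loop_pos _ a b =>
      obtain ⟨rfl, rfl⟩ := ih₁ a
      obtain ⟨rfl, rfl⟩ := ih₂ b
      exact ⟨rfl, rfl⟩
    | loop_neg hn => exact absurd hx hn
  | loop_neg hx =>
    cases h₂ with
    | loop_pos hp _ _ => exact absurd hp hx
    | loop_neg _ => exact ⟨rfl, rfl⟩

/-- The program `p`, started in `s` with random bits `r`, halts within time `T`. -/
def HaltsWithin (r : ℕ → Bool) (p : Prog) (s : State) (T : ℕ) : Prop :=
  ∃ s' t, Exec r p s s' t ∧ t ≤ T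

/-- The program `p`, started in `s` with random bits `r`, halts with output "yes", that is,
with the value `1` in register `0`. -/
def AnswersYes (r : ℕ → Bool) (p : Prog) (s : State) : Prop :=
  ∃ s' t, Exec r p s s' t ∧ s'.reg 0 = 1

/-- The program `p`, started in `s` with random bits `r`, halts with output "no", that is,
with a value other than `1` in register `0`. -/
def AnswersNo (r : ℕ → Bool) (p : Prog) (s : State) : Prop :=
  ∃ s' t, Exec r p s s' t ∧ s'.reg 0 ≠ 1

/-- The law of an infinite sequence of independent fair random bits. -/
noncomputable def fairBits : MeasureTheory.Measure (ℕ → Bool) :=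
  MeasureTheory.Measure.infinitePi fun _ : ℕ => (PMF.uniformOfFintype Bool).toMeasure

open Classical in
/-- The input state for a graph `G` on the vertices `0, …, n - 1`, a layout `π` (a bijection from
vertices to positions) and a number of colors `q`: register `0` holds `n`, register `1` holds `q`,
cell `i < n` holds the vertex at position `i`, cell `n + n * u + v` holds the adjacency bit of the
vertices `u` and `v`, and everything else is zero. -/
noncomputable def input {n : ℕ} (G : SimpleGraph (Fin n)) (π : Fin n ≃ Fin n) (q : ℕ) : State where
  reg x := if x = 0 then (n : ℤ) else if x = 1 then (q : ℤ) else 0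
  mem a :=
    if h : 0 ≤ a ∧ a < n then ((π.symm ⟨a.toNat, by omega⟩ : ℕ) : ℤ)
    else if ∃ u v : Fin n, G.Adj u v ∧ a = n + n * (u : ℕ) + (v : ℕ) then 1
    else 0
  used := 0

end CoinRAM

/-- The cutwidth of `G` with respect to the linear layout `π`: the maximum, over `1 ≤ i < n`, of
the number of edges `{u, v}` for which `u` is among the first `i` vertices of the layout and `v`
is not. Positions are counted from `0`. -/
noncomputable def SimpleGraph.layoutCutwidth {V : Type*} {n : ℕ} (G : SimpleGraph V)
    (π : V ≃ Fin n) : ℕ :=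
  (Finset.Ico 1 n).sup fun i =>
    {e ∈ G.edgeSet | ∃ u v : V, e = s(u, v) ∧ (π u : ℕ) < i ∧ i ≤ (π v : ℕ)}.ncard

/-!
# Coloring in time `2 ^ ctw`

Let the positions of the layout be `0, …, n - 1` and give position `p` a weight `x p`. The sum

`∑ c : positions → {0, …, q - 1}, ∏ p, x p ^ c p * ∏ edges {w < p}, (c p - c w)`

is a polynomial in the weights. Different colorings have different monomials, and the coefficient of
a coloring is nonzero exactly if the coloring is proper. So the polynomial is nonzero if and only if
the graph is `q`-colorable, and by the Schwartz-Zippel lemma (`fairBits_count_eq_zero_le`) its value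
at random integers of `3 * n + 1` bits then vanishes with probability at most `2 ^ (-(n + 1))`, as
long as `q < n`. If `q ≥ n`, the answer is "yes" anyway. A nonzero value is a proof of colorability,
so "yes" is never wrong.

The value is computed vertex by vertex, from the last position to the first one. When the positions
from `p` on have been dealt with, the partial sum (`suffixCount`) is a polynomial in the colors `z w`
of the positions `w < p`, whose degree in `z w` is at most the number `d w` of neighbors of `w` among
the positions from `p` on. Its coefficient table has `∏ (d w + 1) ≤ 2 ^ (∑ d w)` entries, and `∑ d w`
is the number of edges that cross `p`, so at most the cutwidth (`size_radix_le_two_pow`). To treat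
the next position, its color takes all values (`contract`), the polynomial is multiplied by `c - z w`
for each edge to an earlier position (`expand`), which raises one radix of the index system by one,
and the results are added up with the powers of the weight (`collapse`). No prime modulus is needed:
all numbers are integers of polynomially many bits, since each step multiplies the largest entry by
at most `stepFactor n`.

The machine program is verified in a small logic of total correctness with time bounds (`Tr`). Its
time unit is `L + 1`, where `L` bounds the lengths of all values at the boundaries of assignments;
within an assignment the lengths grow by a constant factor only, which a compiler for
expressions (`Expr.code`) accounts for.
-/

namespace CoinRAM

/-! ### Lengths -/

theorem len_le_iff {a : ℤ} {L : ℕ} : len a ≤ L ↔ |a| < 2 ^ L := by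
  rw [len, Nat.size_le, Int.abs_eq_natAbs]
  exact_mod_cast Iff.rfl

theorem len_zero : len 0 = 0 := rfl

theorem len_eval_le (o : Op) (a b : ℤ) : len (o.eval a b) ≤ len a + len b + 1 := by
  have ha : |a| < 2 ^ len a := len_le_iff.1 le_rfl
  have hb : |b| < 2 ^ len b := len_le_iff.1 le_rfl
  have hA : (1 : ℤ) ≤ 2 ^ len a := one_le_pow₀ (by norm_num)
  have hB : (1 : ℤ) ≤ 2 ^ len b := one_le_pow₀ (by norm_num)
  have hsum : |a| + |b| < 2 ^ (len a + len b + 1) := by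
    rw [pow_succ, pow_add]; nlinarith
  rw [len_le_iff]
  cases o with
  | add => exact (abs_add_le a b).trans_lt hsum
  | sub => exact (abs_sub a b).trans_lt hsum
  | mul =>
    simp only [Op.eval]
    rw [abs_mul, pow_succ, pow_add]
    nlinarith [abs_nonneg a, abs_nonneg b]
  | div =>
    have h : |a / b| ≤ |a| := Int.abs_ediv_le_abs a b
    exact h.trans_lt (by linarith [abs_nonneg b])

/-! ### Expressions and their compilation -/

/-- Arithmetic expressions over registers, with memory accesses. -/
inductive Expr where
  | reg (x : ℕ)
  | lit (c : ℤ)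
  | op (o : Op) (e₁ e₂ : Expr)
  | ld (e : Expr)

namespace Expr

/-- The value of an expression in a state. -/
def eval (s : State) : Expr → ℤ
  | reg x => s.reg x
  | lit c => c
  | op o a b => o.eval (a.eval s) (b.eval s)
  | ld e => s.mem (e.eval s)

/-- The expression reads only program variables, which are the registers below `32`; all other
registers are scratch space. -/
def Ok : Expr → Prop
  | reg x => x < 32
  | lit _ => True
  | op _ a b => a.Ok ∧ b.Ok
  | ld e => e.Ok

/-- Code that leaves the value of the expression in register `t`. It uses the registers from `t`
on as a stack and leaves those above `t` zero if they were zero before. -/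
def code : Expr → ℕ → Prog
  | reg x, t => .seq (.const t 0) (.arith .add t x t)
  | lit c, t => .const t c
  | op o a b, t => .seq (a.code t) (.seq (b.code (t + 1))
      (.seq (.arith o t t (t + 1)) (.const (t + 1) 0)))
  | ld e, t => .seq (e.code t) (.load t t)

/-- If all registers and cells have length at most `L`, then the value of the expression has length
less than `width * (L + 1)`. -/
def width : Expr → ℕ
  | reg _ => 1
  | lit c => len c + 1
  | op _ a b => a.width + b.width
  | ld _ => 1

/-- If all registers and cells have length at most `L`, then the code of the expression runs in time
at most `cost * (L + 1)`. -/
def cost : Expr → ℕ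
  | reg _ => 2
  | lit c => len c + 1
  | op _ a b => a.cost + b.cost + (a.width + b.width)
  | ld e => e.cost + e.width + 1

end Expr

/-- All program variables and memory cells hold numbers of at most `L` bits. -/
def State.Bounded (L : ℕ) (s : State) : Prop :=
  (∀ x, x < 32 → len (s.reg x) ≤ L) ∧ ∀ a, len (s.mem a) ≤ L

/-- All scratch registers are zero, and all values have at most `L` bits. -/
def State.Good (L : ℕ) (s : State) : Prop :=
  (∀ x, 32 ≤ x → s.reg x = 0) ∧ s.Bounded L

@[simp] theorem State.setReg_reg (s : State) (x : ℕ) (a : ℤ) (y : ℕ) :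
    (s.setReg x a).reg y = if y = x then a else s.reg y := by
  simp [State.setReg, Function.update_apply]

@[simp] theorem State.setReg_mem (s : State) (x : ℕ) (a : ℤ) : (s.setReg x a).mem = s.mem := rfl

@[simp] theorem State.setReg_used (s : State) (x : ℕ) (a : ℤ) : (s.setReg x a).used = s.used := rfl

@[simp] theorem State.setMem_reg (s : State) (a b : ℤ) : (s.setMem a b).reg = s.reg := rfl

theorem State.setMem_mem (s : State) (a b : ℤ) (c : ℤ) :
    (s.setMem a b).mem c = if c = a then b else s.mem c := by
  simp [State.setMem, Function.update_apply]

@[simp] theorem State.setMem_used (s : State) (a b : ℤ) : (s.setMem a b).used = s.used := rfl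

theorem State.ext_fields {s s' : State} (h₁ : ∀ x, s.reg x = s'.reg x) (h₂ : s.mem = s'.mem)
    (h₃ : s.used = s'.used) : s = s' := by
  cases s; cases s'
  simp only at h₁ h₂ h₃
  subst h₂ h₃
  congr
  funext x
  exact h₁ x

theorem Expr.eval_congr {s s' : State} (e : Expr) (he : e.Ok)
    (h : ∀ x, x < 32 → s.reg x = s'.reg x) (hm : s.mem = s'.mem) : e.eval s = e.eval s' := by
  induction e with
  | reg x => exact h x he
  | lit c => rfl
  | op o a b iha ihb => simp only [Expr.eval, iha he.1, ihb he.2]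
  | ld e ih => simp only [Expr.eval, ih he, hm]

theorem Expr.len_eval_lt {L : ℕ} {s : State} (e : Expr) (he : e.Ok)
    (hs : s.Bounded L) : len (e.eval s) + 1 ≤ e.width * (L + 1) := by
  induction e with
  | reg x => simpa [Expr.eval, Expr.width] using hs.1 x he
  | lit c => simp only [Expr.eval, Expr.width]; exact Nat.le_mul_of_pos_right _ (by omega)
  | op o a b iha ihb =>
    have := len_eval_le o (a.eval s) (b.eval s)
    have := iha he.1
    have := ihb he.2
    simp only [Expr.eval, Expr.width, add_mul]
    omega
  | ld e ih => simpa [Expr.eval, Expr.width] using hs.2 _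

theorem Exec.congr_state {r : ℕ → Bool} {p : Prog} {s s₁ s₂ : State} {t : ℕ}
    (h : Exec r p s s₁ t) (e : s₁ = s₂) : Exec r p s s₂ t := e ▸ h

/-- The effect and the running time of the code of an expression. As it cleans up the stack, it
changes no register but `t`. -/
theorem Expr.exec_code (r : ℕ → Bool) (L : ℕ) (e : Expr) (he : e.Ok) (t : ℕ) (ht : 32 ≤ t)
    (s : State) (hz : ∀ y, t < y → s.reg y = 0)
    (hb : s.Bounded L) : ∃ k, Exec r (e.code t) s (s.setReg t (e.eval s)) k ∧ k ≤ e.cost * (L + 1) := by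
  induction e generalizing t s with
  | reg x =>
    have hx : x < 32 := he
    have h1 := Exec.const (r := r) s t 0
    have h2 := Exec.arith (r := r) (s.setReg t 0) .add t x t
    refine ⟨_, (Exec.seq h1 h2).congr_state ?_, ?_⟩
    · refine State.ext_fields (fun y => ?_) rfl rfl
      by_cases hy : y = t
      · simp [hy, Op.eval, Expr.eval, show x ≠ t by omega]
      · simp [hy]
    · have := hb.1 x hx
      simp [Expr.cost, show x ≠ t by omega, len_zero]
      omega
  | lit c =>
    refine ⟨_, Exec.const s t c, ?_⟩
    simp only [Expr.cost]
    nlinarith [Nat.zero_le (len c * L)]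
  | op o a b iha ihb =>
    obtain ⟨k₁, h₁, hk₁⟩ := iha he.1 t ht s hz hb
    have hz' : ∀ y, t + 1 < y → (s.setReg t (a.eval s)).reg y = 0 := fun y hy => by
      simp [show y ≠ t by omega, hz y (by omega)]
    have hev : ∀ e : Expr, e.Ok → e.eval (s.setReg t (a.eval s)) = e.eval s := fun e he =>
      e.eval_congr he (fun x hx => by simp [show x ≠ t by omega]) rfl
    obtain ⟨k₂, h₂, hk₂⟩ := ihb he.2 (t + 1) (by omega) (s.setReg t (a.eval s)) hz'
      ⟨fun x hx => by simpa [show x ≠ t by omega] using hb.1 x hx, hb.2⟩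
    rw [hev b he.2] at h₂
    refine ⟨_, (Exec.seq h₁ (Exec.seq h₂ (Exec.seq (Exec.arith _ o t t (t + 1))
        (Exec.const _ (t + 1) 0)))).congr_state ?_, ?_⟩
    · refine State.ext_fields (fun y => ?_) rfl rfl
      by_cases hy : y = t + 1
      · simp [hy, hz (t + 1) (by omega)]
      · by_cases hy' : y = t
        · simp [hy', Expr.eval]
        · simp [hy, hy']
    · have ha := a.len_eval_lt he.1 hb
      have hb := b.len_eval_lt he.2 hb
      simp [Expr.cost, len_zero, add_mul]
      omega
  | ld e ih =>
    obtain ⟨k₁, h₁, hk₁⟩ := ih he t ht s hz hb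
    refine ⟨_, (Exec.seq h₁ (Exec.load _ t t)).congr_state ?_, ?_⟩
    · refine State.ext_fields (fun y => ?_) rfl rfl
      by_cases hy : y = t
      · simp [hy, Expr.eval]
      · simp [hy]
    · have h2 := e.len_eval_lt he hb
      have h3 := hb.2 (e.eval s)
      simp [Expr.cost, add_mul]
      omega

/-! ### Structured programs and a logic for them -/

/-- `x := e` -/
def Prog.assign (x : ℕ) (e : Expr) : Prog :=
  .seq (e.code 32) (.seq (.arith .add x 32 33) (.const 32 0))

/-- `memory[e₁] := e₂` -/
def Prog.put (e₁ e₂ : Expr) : Prog :=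
  .seq (e₁.code 32) (.seq (e₂.code 33) (.seq (.store 32 33) (.seq (.const 32 0) (.const 33 0))))

/-- Execute `p` for the values `e - 1, …, 1, 0` of `x`. -/
def Prog.forDown (x : ℕ) (e : Expr) (p : Prog) : Prog :=
  .seq (.assign x e) (.loop x (.seq (.assign x (.op .sub (.reg x) (.lit 1))) p))

/-- Started in the state `s`, if this is good for `L`, the program `p` takes time at most
`k * (L + 1)` and halts in a good state that satisfies `Q`. The rules for this relation are applied
forwards: the postcondition of the first part of a sequence is the relation for the rest. -/
def Tr (r : ℕ → Bool) (L k : ℕ) (p : Prog) (s : State) (Q : State → Prop) : Prop :=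
  s.Good L → ∃ s' t, Exec r p s s' t ∧ t ≤ k * (L + 1) ∧ s'.Good L ∧ Q s'

variable {r : ℕ → Bool} {L k k₁ k₂ : ℕ} {p p₁ p₂ : Prog} {s : State} {Q R : State → Prop}

theorem Tr.mono (h : Tr r L k₁ p s R) (hk : k₁ ≤ k₂) (hQ : ∀ s', s'.Good L → R s' → Q s') :
    Tr r L k₂ p s Q := fun hs => by
  obtain ⟨s', t, he, ht, hg, hR⟩ := h hs
  exact ⟨s', t, he, ht.trans (Nat.mul_le_mul_right _ hk), hg, hQ s' hg hR⟩

theorem Tr.seq (h : Tr r L k₁ p₁ s fun s' => Tr r L k₂ p₂ s' Q) :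
    Tr r L (k₁ + k₂) (.seq p₁ p₂) s Q := fun hs => by
  obtain ⟨s₁, t₁, he₁, ht₁, hg₁, h₂⟩ := h hs
  obtain ⟨s₂, t₂, he₂, ht₂, hg₂, hQ⟩ := h₂ hg₁
  exact ⟨s₂, t₁ + t₂, .seq he₁ he₂, by rw [add_mul]; omega, hg₂, hQ⟩

theorem Tr.skip (h : Q s) : Tr r L 1 .skip s Q := fun hs =>
  ⟨s, 1, .skip s, by omega, hs, h⟩

theorem State.Good.setReg (hs : s.Good L) {x : ℕ} (hx : x < 32) {a : ℤ} (ha : len a ≤ L) :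
    (s.setReg x a).Good L := by
  refine ⟨fun y hy => ?_, fun y hy => ?_, hs.2.2⟩
  · simpa [show y ≠ x by omega] using hs.1 y hy
  · rw [State.setReg_reg]; split_ifs
    · exact ha
    · exact hs.2.1 y hy

theorem State.Good.setMem (hs : s.Good L) {a b : ℤ} (hb : len b ≤ L) :
    (s.setMem a b).Good L := by
  refine ⟨hs.1, hs.2.1, fun c => ?_⟩
  rw [State.setMem_mem]; split_ifs
  · exact hb
  · exact hs.2.2 c

theorem Tr.assign {x : ℕ} {e : Expr} (hx : x < 32) (he : e.Ok)
    (hl : s.Good L → len (e.eval s) ≤ L) (hQ : Q (s.setReg x (e.eval s))) :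
    Tr r L (e.cost + e.width + 1) (.assign x e) s Q := fun hs => by
  obtain ⟨k₁, h₁, hk₁⟩ := e.exec_code r L he 32 le_rfl s (fun y hy => hs.1 y hy.le)
    hs.2
  refine ⟨s.setReg x (e.eval s), _, (Exec.seq h₁ (Exec.seq (Exec.arith _ .add x 32 33)
    (Exec.const _ 32 0))).congr_state ?_, ?_, hs.setReg hx (hl hs), hQ⟩
  · refine State.ext_fields (fun y => ?_) rfl rfl
    have h32 := hs.1 32 le_rfl
    have h33 := hs.1 33 (by omega)
    by_cases hy : y = x
    · simp [hy, Op.eval, h33, show x ≠ 32 by omega]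
    · by_cases hy' : y = 32
      · simp [hy', h32, show 32 ≠ x by omega]
      · simp [hy, hy']
  · have := e.len_eval_lt he hs.2
    have h33 := hs.1 33 (by omega)
    simp [h33, len_zero, add_mul]
    omega

theorem Tr.put {e₁ e₂ : Expr} (he₁ : e₁.Ok) (he₂ : e₂.Ok)
    (hl : s.Good L → len (e₂.eval s) ≤ L) (hQ : Q (s.setMem (e₁.eval s) (e₂.eval s))) :
    Tr r L (e₁.cost + e₂.cost + (e₁.width + e₂.width) + 1) (.put e₁ e₂) s Q := fun hs => by
  obtain ⟨k₁, h₁, hk₁⟩ := e₁.exec_code r L he₁ 32 le_rfl s (fun y hy => hs.1 y hy.le)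
    hs.2
  obtain ⟨k₂, h₂, hk₂⟩ := e₂.exec_code r L he₂ 33 (by omega) (s.setReg 32 (e₁.eval s))
    (fun y hy => by simpa [show y ≠ 32 by omega] using hs.1 y (by omega))
    ⟨fun y hy => by simpa [show y ≠ 32 by omega] using hs.2.1 y hy, hs.2.2⟩
  have hev : e₂.eval (s.setReg 32 (e₁.eval s)) = e₂.eval s :=
    e₂.eval_congr he₂ (fun x hx => by simp [show x ≠ 32 by omega]) rfl
  rw [hev] at h₂
  refine ⟨s.setMem (e₁.eval s) (e₂.eval s), _, (Exec.seq h₁ (Exec.seq h₂ (Exec.seq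
    (Exec.store _ 32 33) (Exec.seq (Exec.const _ 32 0) (Exec.const _ 33 0))))).congr_state ?_, ?_,
    hs.setMem (hl hs), hQ⟩
  · have h32 := hs.1 32 le_rfl
    have h33 := hs.1 33 (by omega)
    refine State.ext_fields (fun y => ?_) ?_ rfl
    · by_cases hy : y = 33
      · simp [hy, h33]
      · by_cases hy' : y = 32
        · simp [hy', h32]
        · simp [hy, hy']
    · simp [State.setMem]
  · have := e₁.len_eval_lt he₁ hs.2
    have := e₂.len_eval_lt he₂ hs.2
    simp [len_zero, add_mul]
    omega

theorem Tr.flip {x : ℕ} (hx : x < 32) (hL : 1 ≤ L)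
    (hQ : Q { s.setReg x (if r s.used then 1 else 0) with used := s.used + 1 }) :
    Tr r L 1 (.flip x) s Q := fun hs => by
  have hg : (s.setReg x (if r s.used then 1 else 0)).Good L := hs.setReg hx (by
    rw [len_le_iff]
    have : (2 : ℤ) ^ 1 ≤ 2 ^ L := pow_le_pow_right₀ (by norm_num) hL
    split_ifs <;> simp only [abs_one, abs_zero] <;> linarith)
  exact ⟨_, 1, .flip s x, by omega, ⟨hg.1, hg.2⟩, hQ⟩

theorem Tr.cond {x : ℕ} (hx : x < 32) (h₁ : 0 < s.reg x → Tr r L k p₁ s Q)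
    (h₂ : ¬ 0 < s.reg x → Tr r L k p₂ s Q) :
    Tr r L (k + 1) (.cond x p₁ p₂) s Q := fun hs => by
  have hl := hs.2.1 x hx
  by_cases hpos : 0 < s.reg x
  · obtain ⟨s', t, he, ht, hg, hQ⟩ := h₁ hpos hs
    exact ⟨s', _, .cond_pos hpos he, by rw [add_mul]; omega, hg, hQ⟩
  · obtain ⟨s', t, he, ht, hg, hQ⟩ := h₂ hpos hs
    exact ⟨s', _, .cond_neg hpos he, by rw [add_mul]; omega, hg, hQ⟩

/-- The rule for counting loops. The invariant `I j` holds when the values of the counter from `j` on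
have been dealt with. -/
theorem Tr.forDown {x : ℕ} {e : Expr} {N : ℕ} (I : ℕ → State → Prop) (hx : x < 32) (he : e.Ok)
    (hN : e.eval s = N) (hNL : N < 2 ^ L)
    (h0 : I N (s.setReg x N))
    (hstep : ∀ j < N, ∀ s' : State, s'.Good L → s'.reg x = (j + 1 : ℕ) → I (j + 1) s' →
      Tr r L k p (s'.setReg x j) fun s'' => s''.reg x = j ∧ I j s'') :
    Tr r L ((k + 12) * N + (e.cost + e.width + 2)) (.forDown x e p) s
      fun s' => s'.reg x = 0 ∧ I 0 s' := by
  have hlen : ∀ j : ℕ, j ≤ N → len (j : ℤ) ≤ L := fun j hj => by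
    rw [len_le_iff]; simp only [Nat.abs_cast]; exact_mod_cast hj.trans_lt hNL
  have hloop : ∀ j ≤ N, ∀ s' : State, s'.reg x = j → I j s' →
      Tr r L ((k + 12) * j + 1)
        (.loop x (.seq (.assign x (.op .sub (.reg x) (.lit 1))) p)) s'
        fun s' => s'.reg x = 0 ∧ I 0 s' := by
    intro j
    induction j with
    | zero =>
      intro _ s' h1 h2 hg
      exact ⟨s', _, .loop_neg (by simp [h1]), by simp [h1, len_zero], hg, by simpa using h1, h2⟩
    | succ j ih =>
      intro hj s' h1 h2 hg
      have hev : (Expr.op .sub (.reg x) (.lit 1)).eval s' = j := by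
        simp [Expr.eval, Op.eval, h1]
      obtain ⟨s₁, t₁, e₁, ht₁, hg₁, hx₁, hI₁⟩ := Tr.seq (r := r) (p₁ := .assign x _) (Tr.assign
        (r := r) hx (e := .op .sub (.reg x) (.lit 1)) ⟨hx, trivial⟩
        (fun _ => by rw [hev]; exact hlen j (by omega))
        (by rw [hev]; exact hstep j (by omega) s' hg h1 h2)) hg
      obtain ⟨s₂, t₂, e₂, ht₂, hg₂, hQ⟩ := ih (by omega) s₁ hx₁ hI₁ hg₁
      refine ⟨s₂, _, .loop_pos (by rw [h1]; positivity) e₁ e₂, ?_, hg₂, hQ⟩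
      have h3 := hg.2.1 x hx
      have hc : (Expr.op .sub (.reg x) (.lit 1)).cost + (Expr.op .sub (.reg x) (.lit 1)).width + 1
        = 11 := by
        simp [Expr.cost, Expr.width, show len 1 = 1 from rfl]
      rw [hc] at ht₁
      have : ((k + 12) * (j + 1) + 1) * (L + 1)
        = (k + 12) * (L + 1) + ((k + 12) * j + 1) * (L + 1) := by ring
      rw [this]
      have : (k + 12) * (L + 1) = (11 + k) * (L + 1) + (L + 1) := by
        ring
      omega
  refine (Tr.seq (r := r) (Tr.assign (r := r) hx he (fun _ => by rw [hN]; exact hlen N le_rfl)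
    (by rw [hN]; exact hloop N le_rfl _ (by simp) h0))).mono ?_ fun _ _ h => h
  omega

end CoinRAM

namespace CutwidthColoring

open Finset

/-! ### Polynomials as tables -/

/-- The number of monomials in the first `k` variables when the degree of variable `w` is less
than `D w`. -/
def size (D : ℕ → ℕ) (k : ℕ) : ℕ := ∏ w ∈ range k, D w

/-- The value at `z` of the polynomial in the first `k` variables with coefficient table `T`: the
degree in variable `w` is less than `D w`, and the exponents are the digits of the table index in
the mixed radix system in which the digit of `w` has weight `size D w`. -/
def tableEval (D : ℕ → ℕ) (z : ℕ → ℤ) : ℕ → (ℕ → ℤ) → ℤ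
  | 0, T => T 0
  | k + 1, T => ∑ a ∈ range (D k), z k ^ a * tableEval D z k fun j => T (a * size D k + j)

theorem size_succ (D : ℕ → ℕ) (k : ℕ) : size D (k + 1) = size D k * D k := prod_range_succ _ _

theorem size_congr {D D' : ℕ → ℕ} {k : ℕ} (h : ∀ w < k, D w = D' w) : size D k = size D' k :=
  prod_congr rfl fun w hw => h w (mem_range.1 hw)

theorem size_pos {D : ℕ → ℕ} {k : ℕ} (h : ∀ w < k, 0 < D w) : 0 < size D k :=
  prod_pos fun w hw => h w (mem_range.1 hw)

theorem tableEval_congr {D D' : ℕ → ℕ} {z z' : ℕ → ℤ} {k : ℕ} {T T' : ℕ → ℤ}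
    (hD : ∀ w < k, D w = D' w) (hz : ∀ w < k, z w = z' w) (hT : ∀ j < size D k, T j = T' j) :
    tableEval D z k T = tableEval D' z' k T' := by
  induction k generalizing T T' with
  | zero => exact hT 0 (by simp [size])
  | succ k ih =>
    have hs : size D' k = size D k := (size_congr fun w hw => hD w (by omega)).symm
    simp only [tableEval, ← hD k (by omega), ← hz k (by omega), hs]
    refine sum_congr rfl fun a ha => congrArg _ (ih (fun w hw => hD w (by omega))
      (fun w hw => hz w (by omega)) fun j hj => hT _ ?_)
    rw [size_succ]
    have := mem_range.1 ha
    nlinarith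

theorem tableEval_sum {ι : Type*} (s : Finset ι) (D : ℕ → ℕ) (z : ℕ → ℤ) (k : ℕ) (f : ι → ℤ)
    (T : ι → ℕ → ℤ) :
    tableEval D z k (fun j => ∑ i ∈ s, f i * T i j) = ∑ i ∈ s, f i * tableEval D z k (T i) := by
  induction k generalizing T with
  | zero => rfl
  | succ k ih =>
    simp only [tableEval, ih, mul_sum]
    rw [sum_comm]
    exact sum_congr rfl fun i _ => sum_congr rfl fun a _ => by ring

theorem tableEval_combination (D : ℕ → ℕ) (z : ℕ → ℤ) (k : ℕ) (u v : ℤ) (S T : ℕ → ℤ) :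
    tableEval D z k (fun j => u * S j - v * T j)
      = u * tableEval D z k S - v * tableEval D z k T := by
  induction k generalizing S T with
  | zero => rfl
  | succ k ih =>
    simp only [tableEval, ih, mul_sum, ← sum_sub_distrib]
    exact sum_congr rfl fun a _ => by ring

/-- Multiplication of a table by `c - z w`, where `S` is the weight of the digit of `w` and `e` its
radix in the old table; in the new table this radix is `e + 1`. -/
def expand (c : ℤ) (S e : ℕ) (T : ℕ → ℤ) (j : ℕ) : ℤ :=
  (if j / S % (e + 1) < e then
      c * T ((j / S / (e + 1) * e + j / S % (e + 1)) * S + j % S) else 0) -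
    if 0 < j / S % (e + 1) then
      T ((j / S / (e + 1) * e + (j / S % (e + 1) - 1)) * S + j % S) else 0

/-- The digits above that of `w` contribute the same cofactor `H` to both sizes. -/
theorem exists_size_eq {D D' : ℕ → ℕ} {w k : ℕ} (hk : w < k) (hw : D' w = D w + 1)
    (h : ∀ v < k, v ≠ w → D' v = D v) :
    ∃ H, size D k = size D w * D w * H ∧ size D' k = size D w * (D w + 1) * H := by
  refine ⟨∏ v ∈ Ico (w + 1) k, D v, ?_, ?_⟩
  · rw [← size_succ, size, size, prod_range_mul_prod_Ico _ hk]
  · rw [← hw, ← size_congr (D := D') (k := w) fun v hv => h v (by omega) (by omega),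
      ← size_succ, size, size, ← prod_range_mul_prod_Ico _ hk]
    congr 1
    refine prod_congr rfl fun v hv => ?_
    have := mem_Ico.1 hv
    exact h v (by omega) (by omega)

/-- The case that `w` is the top variable. -/
theorem tableEval_expand_top {D D' : ℕ → ℕ} (z : ℕ → ℤ) (c : ℤ) (T : ℕ → ℤ) {w : ℕ}
    (hD : ∀ v < w, 0 < D v) (hw : D' w = D w + 1) (h : ∀ v < w, D' v = D v) :
    tableEval D' z (w + 1) (expand c (size D w) (D w) T)
      = (c - z w) * tableEval D z (w + 1) T := by
  have hS := size_pos hD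
  have hsz : size D' w = size D w := size_congr h
  set S := size D w with hSdef
  have key : ∀ a < D w + 1, ∀ j < S, expand c S (D w) T (a * S + j)
      = (if a < D w then c else 0) * T (a * S + j)
        - (if 0 < a then 1 else 0) * T ((a - 1) * S + j) := by
    intro a ha j hj
    have h1 : (a * S + j) / S = a := by
      rw [mul_comm, Nat.mul_add_div hS, Nat.div_eq_of_lt hj, add_zero]
    have h2 : (a * S + j) % S = j := by
      rw [mul_comm, Nat.mul_add_mod, Nat.mod_eq_of_lt hj]
    rw [expand, h1, h2, Nat.mod_eq_of_lt ha, Nat.div_eq_of_lt ha]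
    simp only [zero_mul, zero_add]
    split_ifs <;> simp
  have h3 : tableEval D' z (w + 1) (expand c S (D w) T)
      = ∑ a ∈ range (D w + 1), z w ^ a *
        ((if a < D w then c else 0) * tableEval D z w (fun j => T (a * S + j))
          - (if 0 < a then 1 else 0) * tableEval D z w (fun j => T ((a - 1) * S + j))) := by
    simp only [tableEval, hw, hsz]
    refine sum_congr rfl fun a ha => congrArg _ ?_
    rw [← tableEval_combination]
    exact tableEval_congr h (fun _ _ => rfl) fun j hj =>
      key a (mem_range.1 ha) j (by rwa [hsz] at hj)
  rw [h3]
  simp only [mul_sub, sum_sub_distrib, tableEval, ← hSdef]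
  rw [sum_range_succ, sum_range_succ' (fun a => z w ^ a * ((if 0 < a then 1 else 0) * _))]
  simp only [lt_irrefl, if_false, zero_mul, mul_zero, add_zero, Nat.succ_pos, if_true, one_mul,
    Nat.add_sub_cancel, mul_sum, ← sum_sub_distrib]
  exact sum_congr rfl fun a ha => by rw [if_pos (mem_range.1 ha)]; ring

theorem tableEval_expand {D D' : ℕ → ℕ} (z : ℕ → ℤ) (c : ℤ) (T : ℕ → ℤ) {w k : ℕ} (hk : w < k)
    (hD : ∀ v < k, 0 < D v) (hw : D' w = D w + 1) (h : ∀ v < k, v ≠ w → D' v = D v) :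
    tableEval D' z k (expand c (size D w) (D w) T) = (c - z w) * tableEval D z k T := by
  induction k, hk using Nat.le_induction generalizing T with
  | base =>
    exact tableEval_expand_top z c T (fun v hv => hD v (Nat.lt_succ_of_lt hv)) hw
      (fun v hv => h v (Nat.lt_succ_of_lt hv) hv.ne)
  | succ k hk ih =>
    have hk' : w < k := hk
    rw [tableEval, tableEval, h k (by omega) (by omega), mul_sum]
    refine sum_congr rfl fun a _ => ?_
    rw [mul_left_comm, ← ih (fun j => T (a * size D k + j)) (fun v hv => hD v (by omega))
      fun v hv => h v (by omega)]
    congr 2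
    funext j
    -- a step of the top digit shifts the table index by a multiple of the weight of the digit of `w`
    obtain ⟨H, h1, h2⟩ := exists_size_eq hk' hw fun v hv => h v (by omega)
    have hS : 0 < size D w := size_pos fun v hv => hD v (by omega)
    set S := size D w
    set e := D w
    have e1 : (a * size D' k + j) / S = a * H * (e + 1) + j / S := by
      rw [h2, show a * (S * (e + 1) * H) + j = S * (a * H * (e + 1)) + j by ring,
        Nat.mul_add_div hS]
    have e2 : (a * size D' k + j) % S = j % S := by
      rw [h2, show a * (S * (e + 1) * H) + j = S * (a * H * (e + 1)) + j by ring,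
        Nat.mul_add_mod]
    have e3 : (a * H * (e + 1) + j / S) % (e + 1) = j / S % (e + 1) := by
      rw [mul_comm, Nat.mul_add_mod]
    have e4 : (a * H * (e + 1) + j / S) / (e + 1) = a * H + j / S / (e + 1) := by
      rw [mul_comm, Nat.mul_add_div (by omega)]
    have e5 : ∀ i l, ((a * H + j / S / (e + 1)) * e + i) * S + l
        = a * (S * e * H) + ((j / S / (e + 1) * e + i) * S + l) := fun i l => by ring
    simp only [expand, e1, e2, e3, e4, h1, e5]

/-- The tables for all values `c < q` of a further variable are kept interleaved: the entry `j` for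
the value `c` has index `j * q + c`. This is `expand` for all of them together. -/
def expandAll (q S e : ℕ) (T : ℕ → ℤ) (j : ℕ) : ℤ :=
  (if j / S % (e + 1) < e then
      (j % q : ℕ) * T ((j / S / (e + 1) * e + j / S % (e + 1)) * S + j % S) else 0) -
    if 0 < j / S % (e + 1) then
      T ((j / S / (e + 1) * e + (j / S % (e + 1) - 1)) * S + j % S) else 0

/-- The common treatment of all `c < q` is correct because `j * q + c` has the digits of `j`, the weight
of each being multiplied by `q`. -/
theorem expandAll_interleaved {q c : ℕ} (hc : c < q) (S e : ℕ) (T : ℕ → ℤ) (j : ℕ) :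
    expandAll q (q * S) e T (j * q + c) = expand c S e (fun i => T (i * q + c)) j := by
  have h1 : (j * q + c) / (q * S) = j / S := by
    rw [← Nat.div_div_eq_div_mul, mul_comm, Nat.mul_add_div (by omega), Nat.div_eq_of_lt hc,
      add_zero]
  have h2 : (j * q + c) % q = c := by
    rw [mul_comm, Nat.mul_add_mod, Nat.mod_eq_of_lt hc]
  have h3 : (j * q + c) % (q * S) = j % S * q + c := by
    rw [Nat.mod_mul, h2, mul_comm j q, Nat.mul_add_div (by omega), Nat.div_eq_of_lt hc, add_zero]
    ring
  have h4 : ∀ a : ℕ, a * (q * S) + (j % S * q + c) = (a * S + j % S) * q + c := fun a => by ring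
  simp only [expandAll, expand, h1, h2, h3, h4]

theorem abs_expandAll_le {q S e : ℕ} (hq : 0 < q) (he : 0 < e) {T : ℕ → ℤ} {b : ℤ} {N : ℕ}
    (hT : ∀ j < N * e * S, |T j| ≤ b) {j : ℕ} (hj : j < N * (e + 1) * S) :
    |expandAll q S e T j| ≤ (q + 1) * b := by
  have hS : 0 < S := Nat.pos_of_ne_zero fun h => by simp [h] at hj
  have hh : j / S / (e + 1) < N := by
    rw [Nat.div_div_eq_div_mul, Nat.div_lt_iff_lt_mul (by positivity)]
    linarith [mul_comm S (e + 1), mul_assoc N (e + 1) S, congrArg (N * ·) (mul_comm S (e + 1))]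
  have hl : j % S < S := Nat.mod_lt _ hS
  have hbd : ∀ a < e, |T ((j / S / (e + 1) * e + a) * S + j % S)| ≤ b := fun a ha => by
    refine hT _ ?_
    generalize j / S / (e + 1) = h at *
    generalize j % S = l at *
    have h1 : h * e + a + 1 ≤ N * e := by nlinarith
    nlinarith
  have hb : 0 ≤ b := (abs_nonneg _).trans (hbd 0 he)
  have hq : ((j % q : ℕ) : ℤ) ≤ q := by exact_mod_cast (Nat.mod_lt j hq).le
  have h1 : ∀ (P : Prop) [Decidable P] (x : ℤ), (P → |x| ≤ b) → |if P then x else 0| ≤ b := by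
    intro P _ x h
    split_ifs with hP
    · exact h hP
    · simpa using hb
  refine (abs_sub _ _).trans ?_
  rw [← mul_ite_zero, abs_mul, Nat.abs_cast, add_mul (q : ℤ), one_mul]
  refine add_le_add ((mul_le_mul_of_nonneg_right hq (abs_nonneg _)).trans
    (mul_le_mul_of_nonneg_left (h1 _ _ fun h => hbd _ h) (by positivity))) (h1 _ _ fun h => hbd _ ?_)
  have := Nat.mod_lt (j / S) (show 0 < e + 1 by omega)
  omega

/-- The first part of the treatment of a vertex: the top variable takes each value `c < q`. -/
def contract (q R e : ℕ) (T : ℕ → ℤ) (j : ℕ) : ℤ :=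
  ∑ a ∈ range e, T (j / q + a * R) * (j % q : ℕ) ^ a

theorem tableEval_contract {D : ℕ → ℕ} {z : ℕ → ℤ} {k q c : ℕ} (hc : c < q) (T : ℕ → ℤ) :
    tableEval D z k (fun j => contract q (size D k) (D k) T (j * q + c))
      = tableEval D (Function.update z k c) (k + 1) T := by
  have h1 : ∀ j : ℕ, (j * q + c) / q = j := fun j => by
    rw [mul_comm, Nat.mul_add_div (by omega), Nat.div_eq_of_lt hc, add_zero]
  have h2 : ∀ j : ℕ, (j * q + c) % q = c := fun j => by
    rw [mul_comm, Nat.mul_add_mod, Nat.mod_eq_of_lt hc]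
  have h3 : (fun j => contract q (size D k) (D k) T (j * q + c))
      = fun j => ∑ a ∈ range (D k), (c : ℤ) ^ a * T (a * size D k + j) := by
    funext j
    simp only [contract, h1, h2]
    exact sum_congr rfl fun a _ => by rw [mul_comm, add_comm]
  rw [h3, tableEval_sum, tableEval]
  refine sum_congr rfl fun a _ => ?_
  rw [Function.update_self]
  congr 1
  exact tableEval_congr (fun _ _ => rfl) (fun w hw => (Function.update_of_ne hw.ne _ _).symm)
    fun _ _ => rfl

theorem abs_sum_mul_pow_le {f : ℕ → ℤ} {y Y b : ℤ} {t e : ℕ} (hY : 1 ≤ Y) (hy : |y| ≤ Y)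
    (hb : 0 ≤ b) (hf : ∀ a < t, |f a| ≤ b) (ht : t ≤ e) :
    |∑ a ∈ range t, f a * y ^ a| ≤ e * (Y ^ e * b) := by
  have hterm : ∀ a ∈ range t, |f a * y ^ a| ≤ Y ^ e * b := by
    intro a ha
    have ha := mem_range.1 ha
    rw [abs_mul, abs_pow, mul_comm]
    refine mul_le_mul ?_ (hf a ha) (abs_nonneg _) (by positivity)
    exact (pow_le_pow_left₀ (abs_nonneg _) hy a).trans (pow_le_pow_right₀ hY (by omega))
  refine (abs_sum_le_sum_abs _ _).trans ((sum_le_card_nsmul _ _ _ hterm).trans ?_)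
  rw [card_range, nsmul_eq_mul]
  exact mul_le_mul_of_nonneg_right (by exact_mod_cast ht) (by positivity)

/-- The last part of the treatment of a vertex: the sum over its color `c`, with weight `x ^ c`. -/
def collapse (q : ℕ) (x : ℤ) (T : ℕ → ℤ) (j : ℕ) : ℤ :=
  ∑ c ∈ range q, T (j * q + c) * x ^ c

theorem tableEval_collapse (D : ℕ → ℕ) (z : ℕ → ℤ) (k q : ℕ) (x : ℤ) (T : ℕ → ℤ) :
    tableEval D z k (collapse q x T)
      = ∑ c ∈ range q, x ^ c * tableEval D z k fun j => T (j * q + c) := by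
  rw [← tableEval_sum]
  congr 1
  funext j
  exact sum_congr rfl fun c _ => mul_comm _ _

/-! ### The weighted count of colorings -/

open Classical in
/-- The weighted count of the colorings of the last `k` of `n` positions, when the positions before
them have the colors `z`. A coloring `c` counts with the product of all `x p ^ c p` over the last
positions `p` and all `c p - c w` over the edges between a last position `p` and an earlier
position `w`. -/
noncomputable def suffixCount (n q : ℕ) (adj : ℕ → ℕ → Prop) (x : ℕ → ℤ) : ℕ → (ℕ → ℤ) → ℤ
  | 0, _ => 1
  | k + 1, z => ∑ c ∈ range q, x (n - (k + 1)) ^ c *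
      ((∏ w ∈ range (n - (k + 1)) with adj (n - (k + 1)) w, ((c : ℤ) - z w)) *
        suffixCount n q adj x k (Function.update z (n - (k + 1)) c))

open Classical in
theorem suffixCount_step {n q : ℕ} (adj : ℕ → ℕ → Prop) (x : ℕ → ℤ) {p : ℕ} (hp : p < n)
    (z : ℕ → ℤ) :
    suffixCount n q adj x (n - p) z = ∑ c ∈ range q, x p ^ c *
      ((∏ w ∈ range p with adj p w, ((c : ℤ) - z w)) *
        suffixCount n q adj x (n - (p + 1)) (Function.update z p c)) := by
  have h1 : n - p = n - (p + 1) + 1 := by omega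
  have h2 : n - (n - (p + 1) + 1) = p := by omega
  rw [h1, suffixCount, h2]

open Classical in
/-- One more than the number of neighbors of position `w` among the positions from `p` on. When these
have been dealt with, the count is a polynomial whose degree in `z w` is less than this. -/
noncomputable def radix (n : ℕ) (adj : ℕ → ℕ → Prop) (p w : ℕ) : ℕ :=
  #{p' ∈ Ico p n | adj p' w} + 1

open Classical in
theorem radix_step {n : ℕ} (adj : ℕ → ℕ → Prop) {p : ℕ} (hp : p < n) (w : ℕ) :
    radix n adj p w = radix n adj (p + 1) w + if adj p w then 1 else 0 := by
  rw [radix, radix, ← insert_Ico_add_one_left_eq_Ico hp, filter_insert]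
  split_ifs with h
  · rw [card_insert_of_notMem (by simp)]
  · rfl

theorem radix_pos (n : ℕ) (adj : ℕ → ℕ → Prop) (p w : ℕ) : 0 < radix n adj p w := Nat.succ_pos _

theorem radix_self (n : ℕ) (adj : ℕ → ℕ → Prop) (w : ℕ) : radix n adj n w = 1 := by
  simp [radix]

theorem radix_le (n : ℕ) (adj : ℕ → ℕ → Prop) (p w : ℕ) : radix n adj p w ≤ n - p + 1 := by
  classical
  have := card_filter_le (Ico p n) (fun p' => adj p' w)
  rw [Nat.card_Ico] at this
  unfold radix
  convert Nat.succ_le_succ this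
end CutwidthColoring

namespace CoinRAM

open CoinRAM.Expr

theorem len_natCast_le {a L : ℕ} (h : a < 2 ^ L) : len (a : ℤ) ≤ L := by
  rw [len_le_iff, Nat.abs_cast]; exact_mod_cast h

instance : Add Expr := ⟨.op .add⟩
instance : Sub Expr := ⟨.op .sub⟩
instance : Mul Expr := ⟨.op .mul⟩
instance : Div Expr := ⟨.op .div⟩
instance : Mod Expr := ⟨fun a b => a - b * (a / b)⟩

section
variable (s : State) (a b : Expr)

@[simp] theorem eval_add : (a + b).eval s = a.eval s + b.eval s := rfl
@[simp] theorem eval_sub : (a - b).eval s = a.eval s - b.eval s := rfl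
@[simp] theorem eval_mul : (a * b).eval s = a.eval s * b.eval s := rfl
@[simp] theorem eval_div : (a / b).eval s = a.eval s / b.eval s := rfl
@[simp] theorem eval_mod : (a % b).eval s = a.eval s % b.eval s := (Int.emod_def _ _).symm
@[simp] theorem eval_reg (x : ℕ) : (reg x).eval s = s.reg x := rfl
@[simp] theorem eval_lit (c : ℤ) : (lit c).eval s = c := rfl
@[simp] theorem eval_ld : (ld a).eval s = s.mem (a.eval s) := rfl

end

instance decidableOk : DecidablePred Expr.Ok
  | reg x => inferInstanceAs (Decidable (x < 32))
  | lit _ => inferInstanceAs (Decidable True)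
  | op _ a b =>
    have := decidableOk a
    have := decidableOk b
    inferInstanceAs (Decidable (a.Ok ∧ b.Ok))
  | ld e => decidableOk e

/-- The address of entry `j` of array `k`. The arrays are interleaved below address zero, so that
they are unbounded and disjoint from the input. There are four of them: `k < 4`. -/
def addr (k : ℕ) (j : ℤ) : ℤ := -1 - k - 4 * j

theorem addr_inj {k k' : ℕ} (hk : k < 4) (hk' : k' < 4) {i j : ℤ} :
    addr k i = addr k' j ↔ k = k' ∧ i = j := by
  unfold addr; omega

theorem ne_addr {a : ℤ} (ha : 0 ≤ a) (k j : ℕ) : a ≠ addr k j := by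
  unfold addr; omega

/-- The address of an array entry, as an expression. -/
def Expr.arrAddr (k : ℕ) (e : Expr) : Expr := lit (-1 - k) - lit 4 * e

/-- An array entry, as an expression. -/
def Expr.arr (k : ℕ) (e : Expr) : Expr := ld (Expr.arrAddr k e)

@[simp] theorem eval_arrAddr (s : State) (k : ℕ) (e : Expr) :
    (Expr.arrAddr k e).eval s = addr k (e.eval s) := rfl

@[simp] theorem eval_arr (s : State) (k : ℕ) (e : Expr) :
    (Expr.arr k e).eval s = s.mem (addr k (e.eval s)) := rfl

variable {r : ℕ → Bool} {L k k₁ k₂ : ℕ} {p p₁ p₂ : Prog} {s : State} {Q R : State → Prop}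

theorem Tr.assign_val {x : ℕ} {e : Expr} {v : ℤ} (hx : x < 32) (he : e.Ok) (hv : e.eval s = v)
    (hl : len v ≤ L) (hk : e.cost + e.width + 1 ≤ k) (hQ : Q (s.setReg x v)) :
    Tr r L k (.assign x e) s Q := by
  subst hv
  exact (Tr.assign hx he (fun _ => hl) hQ).mono hk fun _ _ h => h

theorem Tr.put_val {e₁ e₂ : Expr} {a v : ℤ} (he₁ : e₁.Ok) (he₂ : e₂.Ok) (ha : e₁.eval s = a)
    (hv : e₂.eval s = v) (hl : s.Good L → len v ≤ L)
    (hk : e₁.cost + e₂.cost + (e₁.width + e₂.width) + 1 ≤ k) (hQ : Q (s.setMem a v)) :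
    Tr r L k (.put e₁ e₂) s Q := by
  subst ha hv
  exact (Tr.put he₁ he₂ hl hQ).mono hk fun _ _ h => h

/-! ### Loops that evaluate a polynomial -/

/-- `s'` differs from `s` only in the registers in `X`. -/
structure SameBut (X : Finset ℕ) (s s' : State) : Prop where
  reg : ∀ y ∉ X, s'.reg y = s.reg y
  mem : s'.mem = s.mem
  used : s'.used = s.used

/-- Put into register `9` the sum of `T (b + a * d) * y ^ a` over all `a < e`, by Horner's rule, where
`T` is array `k` and the registers `15`, `16`, `17`, `18` hold `b`, `d`, `y`, `e`. -/
def Prog.horner (k : ℕ) : Prog :=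
  .seq (.assign 9 (lit 0)) (.forDown 8 (reg 18)
    (.assign 9 (reg 9 * reg 17 + arr k (reg 15 + reg 8 * reg 16))))

open Finset in
theorem Tr.horner (k : ℕ) (hk : k < 4) {b d e : ℕ} {y Y B : ℤ} (hY : 1 ≤ Y) (hy : |y| ≤ Y) (hB : 0 ≤ B)
    (h15 : s.reg 15 = b) (h16 : s.reg 16 = d) (h17 : s.reg 17 = y) (h18 : s.reg 18 = e)
    (hT : ∀ a < e, |s.mem (addr k (b + a * d : ℕ))| ≤ B) (heL : e < 2 ^ L)
    (hL : e * (Y ^ e * B) < 2 ^ L)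
    (hQ : ∀ s', SameBut {8, 9} s s' →
      s'.reg 9 = ∑ a ∈ range e, s.mem (addr k (b + a * d : ℕ)) * y ^ a → Q s') :
    Tr r L (80 * e + 20) (.horner k) s Q := by
  have hcost : (reg 9 * reg 17 + arr k (reg 15 + reg 8 * reg 16)).cost
      + (reg 9 * reg 17 + arr k (reg 15 + reg 8 * reg 16)).width + 1 ≤ 68 := by
    interval_cases k <;> decide
  set f : ℕ → ℤ := fun a => s.mem (addr k (b + a * d : ℕ)) with hf
  set I : ℕ → State → Prop := fun j s' =>
    SameBut {8, 9} s s' ∧ s'.reg 9 = ∑ a ∈ range (e - j), f (j + a) * y ^ a with hI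
  refine (Tr.seq (k₁ := 3) (k₂ := 80 * e + (2 + 1 + 2)) (Tr.assign_val (v := 0) (by norm_num)
    (by decide) rfl (by simp [len_zero]) (by decide) ?_)).mono (by omega) fun _ _ h => h
  refine (Tr.forDown (k := 68) (N := e) I (by norm_num) (by decide) (by simpa using h18) heL ?_ ?_).mono
    (by simp [Expr.cost, Expr.width]) ?_
  · refine ⟨⟨fun y hy => ?_, rfl, rfl⟩, by simp⟩
    simp only [mem_insert, mem_singleton, not_or] at hy
    simp [hy]
  · rintro j hj s' - h8 ⟨h1, h9⟩
    have hsum : f j + (∑ a ∈ range (e - (j + 1)), f (j + 1 + a) * y ^ a) * y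
        = ∑ a ∈ range (e - j), f (j + a) * y ^ a := by
      rw [show e - j = e - (j + 1) + 1 by omega, sum_range_succ' _ (e - (j + 1)), sum_mul]
      simp only [pow_zero, mul_one, add_zero]
      rw [add_comm]
      congr 1
      refine sum_congr rfl fun a _ => ?_
      rw [pow_succ, mul_assoc, show j + 1 + a = j + (a + 1) by ring]
    refine Tr.assign_val (v := ∑ a ∈ range (e - j), f (j + a) * y ^ a) (by norm_num)
      (by interval_cases k <;> decide) ?_ ?_ hcost ?_
    · simp only [eval_add, eval_mul, eval_reg, eval_arr, State.setReg_reg, State.setReg_mem, h1.mem]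
      norm_num
      rw [h9, h1.reg 17 (by decide), h1.reg 15 (by decide), h1.reg 16 (by decide), h15, h16, h17,
        ← hsum, add_comm, hf]
      push_cast
      rfl
    · rw [len_le_iff]
      refine lt_of_le_of_lt (CutwidthColoring.abs_sum_mul_pow_le hY hy hB
        (fun a ha => hT _ (by omega)) (by omega : e - j ≤ e)) (by exact_mod_cast hL)
    · refine ⟨by simp, ⟨fun y hy => ?_, h1.mem, h1.used⟩, by simp⟩
      have := h1.reg y hy
      simp only [mem_insert, mem_singleton, not_or] at hy
      simpa [hy] using this
  · rintro s' - ⟨-, h1, h2⟩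
    exact hQ s' h1 (by simpa [hf] using h2)

/-! ### Loops that fill a table -/

/-- From `s` to `s'` the entries below `N` of array `k` have received the values of `F`, and apart
from that only the registers in `X` have changed. -/
structure Filled (X : Finset ℕ) (k N : ℕ) (F : ℕ → ℤ) (s s' : State) : Prop where
  reg : ∀ y ∉ X, s'.reg y = s.reg y
  cell : ∀ j < N, s'.mem (addr k j) = F j
  mem : ∀ a, (∀ j < N, a ≠ addr k j) → s'.mem a = s.mem a
  used : s'.used = s.used

theorem Filled.other {X : Finset ℕ} {N : ℕ} {F : ℕ → ℤ} {s' : State} (h : Filled X k N F s s')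
    (hk : k < 4) {k' : ℕ} (hk' : k' < 4) (hne : k' ≠ k) (j : ℤ) :
    s'.mem (addr k' j) = s.mem (addr k' j) :=
  h.mem _ fun i _ => by rw [Ne, addr_inj hk' hk]; exact fun h => hne h.1

theorem Filled.nonneg {X : Finset ℕ} {N : ℕ} {F : ℕ → ℤ} {s' : State} (h : Filled X k N F s s')
    {a : ℤ} (ha : 0 ≤ a) : s'.mem a = s.mem a :=
  h.mem _ fun _ _ => ne_addr ha _ _

/-- A loop over register `7` fills a table if each round writes its entry and otherwise changes only
the registers in `X`. -/
theorem Tr.fill {kb N : ℕ} {e : Expr} {F : ℕ → ℤ} (X : Finset ℕ) (k : ℕ) (hk : k < 4) (h7 : 7 ∉ X)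
    (he : e.Ok) (hN : e.eval s = N) (hNL : N < 2 ^ L)
    (hbody : ∀ j < N, ∀ s' : State, s'.Good L → s'.reg 7 = j →
      (∀ y ∉ insert 7 X, s'.reg y = s.reg y) →
      (∀ a, (∀ i < N, a ≠ addr k i) → s'.mem a = s.mem a) →
      Tr r L kb p s' fun s'' => (∀ y ∉ X, s''.reg y = s'.reg y) ∧
        s''.mem = Function.update s'.mem (addr k j) (F j) ∧ s''.used = s'.used)
    (hQ : ∀ s', Filled (insert 7 X) k N F s s' → Q s') :
    Tr r L ((kb + 12) * N + (e.cost + e.width + 2)) (.forDown 7 e p) s Q := by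
  refine (Tr.forDown (k := kb) (N := N) (fun j s' => (∀ y ∉ insert 7 X, s'.reg y = s.reg y) ∧
    (∀ i < N, j ≤ i → s'.mem (addr k i) = F i) ∧
    (∀ a, (∀ i < N, a ≠ addr k i) → s'.mem a = s.mem a) ∧ s'.used = s.used) (by norm_num)
    he hN hNL ?_ ?_).mono le_rfl ?_
  · refine ⟨fun y hy => ?_, fun i hi hi' => by omega, fun a _ => rfl, rfl⟩
    simp only [Finset.mem_insert, not_or] at hy
    simp [hy]
  · rintro j hj s' hg h1 ⟨h2, h3, h4, h5⟩ hg'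
    obtain ⟨s'', t, he, ht, hg'', h6, h7', h8⟩ := hbody j hj (s'.setReg 7 j) hg' (by simp)
      (fun y hy => by
        have := h2 y hy
        simp only [Finset.mem_insert, not_or] at hy
        simpa [hy] using this) h4 hg'
    refine ⟨s'', t, he, ht, hg'', by rw [h6 7 h7]; simp, fun y hy => ?_, fun i hi hji => ?_,
      fun a ha => ?_, by rw [h8]; exact h5⟩
    · have h9 := h2 y hy
      simp only [Finset.mem_insert, not_or] at hy
      rw [h6 y hy.2]
      simpa [hy.1] using h9
    · rw [h7']
      by_cases hij : i = j
      · subst hij; simp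
      · rw [Function.update_of_ne]
        · exact h3 i hi (by omega)
        · rw [Ne, addr_inj hk hk]; omega
    · rw [h7', Function.update_of_ne (ha j hj)]
      exact h4 a ha
  · rintro s' - ⟨-, h1, h2, h3, h4⟩
    exact hQ s' ⟨h1, fun j hj => h2 j hj (Nat.zero_le _), h3, h4⟩

end CoinRAM

namespace CoinRAM

open CoinRAM.Expr CutwidthColoring

/-! ### The parts of the program

The registers below `32` are used as follows.
* `0`, `1`: the numbers `n` of vertices and `q` of colors; at the end `0` is the answer;
* `2`, `13`: the current position and the vertex there; `3`, `4`: its random weight and a random bit;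
* `5`, `7`, `8`, `10`: loop counters, for random bits, table entries, Horner's rule and the earlier
  positions;
* `6`: the size of the current table; `11`, `12`: weight and radix of the digit of the position in
  register `10`; `14`: whether there is an edge to this position;
* `9`, `15`, `16`, `17`, `18`: result and parameters of Horner's rule.

Array `0` is the table between the treatments of two positions, array `1` the interleaved tables
during such a treatment, array `2` a buffer, and array `3` holds the radices of all positions.
-/

/-- The entries of array `k`. -/
def State.arr (s : State) (k : ℕ) (j : ℕ) : ℤ := s.mem (addr k j)

/-- The number with the binary digits `r u, …, r (u + k - 1)`, the first being the leading one. -/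
def bitsValue (r : ℕ → Bool) (u : ℕ) : ℕ → ℕ
  | 0 => 0
  | k + 1 => 2 * bitsValue r u k + if r (u + k) then 1 else 0

theorem bitsValue_lt (r : ℕ → Bool) (u k : ℕ) : bitsValue r u k < 2 ^ k := by
  induction k with
  | zero => simp [bitsValue]
  | succ k ih => rw [bitsValue, pow_succ]; split_ifs <;> omega

/-- Draw a random number of `3 * n + 1` bits into register `3`. -/
def Prog.draw : Prog :=
  .seq (.assign 3 (lit 0)) (.forDown 5 (lit 3 * reg 0 + lit 1)
    (.seq (.flip 4) (.assign 3 (lit 2 * reg 3 + reg 4))))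

/-- Fill array `1` by `contract` from array `0`. -/
def Prog.contract : Prog :=
  .forDown 7 (reg 6) (.seq (.assign 15 (reg 7 / reg 1)) (.seq (.assign 17 (reg 7 % reg 1))
    (.seq (.horner 0) (.put (arrAddr 1 (reg 7)) (reg 9)))))

/-- The value of `expandAll` for array `1`. The case distinctions are made by quotients which are
`0` or `1`. -/
def Expr.expandAll : Expr :=
  let a := reg 7 / reg 11 % (reg 12 + lit 1)
  let h := reg 7 / reg 11 / (reg 12 + lit 1)
  let l := reg 7 % reg 11
  (lit 1 - a / reg 12) * ((reg 7 % reg 1) * arr 1 ((h * reg 12 + a) * reg 11 + l)) -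
    (a + reg 12) / (reg 12 + lit 1) * arr 1 ((h * reg 12 + (a - lit 1)) * reg 11 + l)

/-- Apply `expandAll` to array `1`. -/
def Prog.expand : Prog :=
  .seq (.forDown 7 (reg 6) (.put (arrAddr 2 (reg 7)) Expr.expandAll))
    (.forDown 7 (reg 6) (.put (arrAddr 1 (reg 7)) (arr 2 (reg 7))))

/-- Fill array `0` by `collapse` from array `1`. -/
def Prog.collapse : Prog :=
  .forDown 7 (reg 6) (.seq (.assign 15 (reg 7 * reg 1))
    (.seq (.horner 1) (.put (arrAddr 0 (reg 7)) (reg 9))))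

variable {r : ℕ → Bool} {L k : ℕ} {s : State} {Q : State → Prop}

theorem Tr.draw {n : ℕ} (hL : 3 * n + 1 < L) (h0 : s.reg 0 = n)
    (hQ : ∀ s', (∀ y ∉ ({3, 4, 5} : Finset ℕ), s'.reg y = s.reg y) → s'.mem = s.mem →
      s'.used = s.used + (3 * n + 1) → s'.reg 3 = ((bitsValue r s.used (3 * n + 1) : ℕ) : ℤ) → Q s') :
    Tr r L (50 * (3 * n + 1) + 50) .draw s Q := by
  refine (Tr.seq (k₁ := 3) (k₂ := 50 * (3 * n + 1) + 40) (Tr.assign_val (v := 0) (by norm_num)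
    (by decide) rfl (by simp [len_zero]) (by decide) ?_)).mono (by omega) fun _ _ h => h
  refine (Tr.forDown (k := 38) (N := 3 * n + 1) (fun j s' =>
    (∀ y ∉ ({3, 4, 5} : Finset ℕ), s'.reg y = s.reg y) ∧ s'.mem = s.mem ∧
    s'.used + j = s.used + (3 * n + 1) ∧ s'.reg 3 = bitsValue r s.used (3 * n + 1 - j))
    (by norm_num) (by decide) (by simp [h0]) (hL.trans Nat.lt_two_pow_self) ?_ ?_).mono ?_ ?_
  · refine ⟨fun y hy => ?_, rfl, rfl, by simp [bitsValue]⟩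
    simp only [Finset.mem_insert, Finset.mem_singleton, not_or] at hy
    simp [hy]
  · rintro j hj s' - - ⟨h1, h2, h3, h4⟩
    have hused : s'.used = s.used + (3 * n + 1 - (j + 1)) := by omega
    refine (Tr.seq (k₁ := 1) (k₂ := 37) (Tr.flip (by norm_num) (by omega) ?_)).mono (by omega)
      fun _ _ h => h
    refine Tr.assign_val (v := bitsValue r s.used (3 * n + 1 - j)) (by norm_num) (by decide) ?_
      (len_natCast_le ?_) (by decide) ⟨by simp, fun y hy => ?_, h2, ?_, by simp⟩
    · rw [show 3 * n + 1 - j = 3 * n + 1 - (j + 1) + 1 by omega, bitsValue, ← hused]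
      simp [h4]
      congr
    · exact (bitsValue_lt _ _ _).trans_le (Nat.pow_le_pow_right (by norm_num) (by omega))
    · have h5 := h1 y hy
      simp only [Finset.mem_insert, Finset.mem_singleton, not_or] at hy
      simpa [hy] using h5
    · simp only [State.setReg_used]; omega
  · have : (lit 3 * reg 0 + lit 1).cost + (lit 3 * reg 0 + lit 1).width + 2 ≤ 40 := by decide
    omega
  · rintro s' - ⟨-, h1, h2, h3, h4⟩
    exact hQ s' h1 h2 h3 h4

theorem Tr.contract {q R e : ℕ} {b : ℤ} (hq : 0 < q) (h1 : s.reg 1 = q)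
    (h6 : s.reg 6 = (q * R : ℕ)) (h16 : s.reg 16 = R) (h18 : s.reg 18 = e) (hb : 0 ≤ b)
    (hT : ∀ j < R * e, |s.arr 0 j| ≤ b) (heL : e < 2 ^ L) (hqR : q * R < 2 ^ L)
    (hL : e * ((q : ℤ) ^ e * b) < 2 ^ L) (hqL : q < 2 ^ L)
    (hQ : ∀ s', Filled {7, 8, 9, 15, 17} 1 (q * R) (contract q R e (s.arr 0)) s s' → Q s') :
    Tr r L ((80 * e + 110) * (q * R) + 10) .contract s Q := by
  refine (Tr.fill (kb := 80 * e + 90) (F := CutwidthColoring.contract q R e (s.arr 0))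
    {8, 9, 15, 17} 1 (by norm_num)
    (by decide) (by decide) (by simpa using h6) hqR ?_ hQ).mono ?_ fun _ _ h => h
  · intro j hj s' _ h7 hreg hmem
    have hjR : j / q < R := by rw [Nat.div_lt_iff_lt_mul hq]; linarith [mul_comm q R]
    have h1' : s'.reg 1 = q := by rw [hreg 1 (by decide), h1]
    have h16' : s'.reg 16 = R := by rw [hreg 16 (by decide), h16]
    have h18' : s'.reg 18 = e := by rw [hreg 18 (by decide), h18]
    have harr : ∀ i : ℕ, s'.mem (addr 0 i) = s.arr 0 i := fun i =>
      hmem _ fun j _ => by rw [Ne, addr_inj (by norm_num) (by norm_num)]; omega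
    have hjq := Nat.mod_lt j hq
    refine (Tr.seq (k₁ := 10) (k₂ := 80 * e + 80) (Tr.assign_val (v := (j / q : ℕ)) (by norm_num)
      (by decide) (by simp [h7, h1']) (len_natCast_le ((Nat.div_le_self _ _).trans_lt
        (hj.trans hqR))) (by decide) ?_)).mono (by omega) fun _ _ h => h
    refine (Tr.seq (k₁ := 25) (k₂ := 80 * e + 55) (Tr.assign_val (v := (j % q : ℕ)) (by norm_num)
      (by decide) (by simp [h7, h1']) (len_natCast_le (hjq.trans hqL)) (by decide) ?_)).mono
      (by omega) fun _ _ h => h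
    refine (Tr.seq (k₁ := 80 * e + 20) (k₂ := 35) (Tr.horner 0 (by norm_num) (b := j / q) (d := R)
      (e := e) (y := (j % q : ℕ)) (Y := q) (B := b) (by exact_mod_cast hq)
      (by rw [Nat.abs_cast]; exact_mod_cast hjq.le) hb (by simp) (by simpa using h16') (by simp)
      (by simpa using h18') ?_ heL hL ?_)).mono (by omega) fun _ _ h => h
    · intro a ha
      simp only [State.setReg_mem, harr]
      exact hT _ (by nlinarith)
    · intro s'' hs'' h9
      have h7'' : s''.reg 7 = j := by rw [hs''.reg 7 (by decide)]; simpa using h7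
      refine Tr.put_val (a := addr 1 j) (by decide) (by decide) (by simp [h7'']) rfl
        (fun hg => hg.2.1 9 (by norm_num)) (by decide) ⟨fun y hy => ?_, ?_, ?_⟩
      · simp only [Finset.mem_insert, Finset.mem_singleton, not_or] at hy
        rw [State.setMem_reg, hs''.reg y (by simp [hy])]
        simp [hy]
      · simp only [eval_reg, State.setMem, hs''.mem, h9, State.setReg_mem, harr]
        rfl
      · exact hs''.used
  · have : (reg 6).cost + (reg 6).width + 2 ≤ 10 := by decide
    nlinarith [Nat.zero_le (q * R)]

theorem Tr.collapse {q S : ℕ} {x X b : ℤ} (hX : 1 ≤ X) (hx : |x| ≤ X) (h1 : s.reg 1 = q)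
    (h6 : s.reg 6 = S) (h16 : s.reg 16 = 1) (h17 : s.reg 17 = x) (h18 : s.reg 18 = q) (hb : 0 ≤ b)
    (hT : ∀ j < q * S, |s.arr 1 j| ≤ b) (hqS : q * S < 2 ^ L) (hSL : S < 2 ^ L)
    (hL : q * (X ^ q * b) < 2 ^ L) (hqL : q < 2 ^ L)
    (hQ : ∀ s', Filled {7, 8, 9, 15} 0 S (collapse q x (s.arr 1)) s s' → Q s') :
    Tr r L ((80 * q + 100) * S + 10) .collapse s Q := by
  refine (Tr.fill (kb := 80 * q + 80) (F := CutwidthColoring.collapse q x (s.arr 1))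
    {8, 9, 15} 0 (by norm_num)
    (by decide) (by decide) (by simpa using h6) hSL ?_ hQ).mono ?_ fun _ _ h => h
  · intro j hj s' _ h7 hreg hmem
    have h1' : s'.reg 1 = q := by rw [hreg 1 (by decide), h1]
    have h16' : s'.reg 16 = 1 := by rw [hreg 16 (by decide), h16]
    have h17' : s'.reg 17 = x := by rw [hreg 17 (by decide), h17]
    have h18' : s'.reg 18 = q := by rw [hreg 18 (by decide), h18]
    have harr : ∀ i : ℕ, s'.mem (addr 1 i) = s.arr 1 i := fun i =>
      hmem _ fun j _ => by rw [Ne, addr_inj (by norm_num) (by norm_num)]; omega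
    refine (Tr.seq (k₁ := 10) (k₂ := 80 * q + 60) (Tr.assign_val (v := (j * q : ℕ)) (by norm_num)
      (by decide) (by simp [h7, h1']) (len_natCast_le (by nlinarith)) (by decide) ?_)).mono
      (by omega) fun _ _ h => h
    refine (Tr.seq (k₁ := 80 * q + 20) (k₂ := 35) (Tr.horner 1 (by norm_num) (b := j * q) (d := 1)
      (e := q) (y := x) (Y := X) (B := b) hX hx hb (by simp) (by simpa using h16')
      (by simpa using h17') (by simpa using h18') ?_ hqL hL ?_)).mono (by omega) fun _ _ h => h
    · intro a ha
      simp only [State.setReg_mem, harr]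
      exact hT _ (by nlinarith)
    · intro s'' hs'' h9
      have h7'' : s''.reg 7 = j := by rw [hs''.reg 7 (by decide)]; simpa using h7
      refine Tr.put_val (a := addr 0 j) (by decide) (by decide) (by simp [h7'']) rfl
        (fun hg => hg.2.1 9 (by norm_num)) (by decide) ⟨fun y hy => ?_, ?_, ?_⟩
      · simp only [Finset.mem_insert, Finset.mem_singleton, not_or] at hy
        rw [State.setMem_reg, hs''.reg y (by simp [hy])]
        simp [hy]
      · simp only [eval_reg, State.setMem, hs''.mem, h9, State.setReg_mem, harr, mul_one]
        rfl
      · exact hs''.used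
  · have : (reg 6).cost + (reg 6).width + 2 ≤ 10 := by decide
    nlinarith [Nat.zero_le S]

/-- Where a factor is `0`, the table may be read outside of its range, but this is harmless: every
memory cell holds a number of bounded length. -/
theorem eval_expandAll {q S e j : ℕ} (he : 0 < e) (h1 : s.reg 1 = q) (h7 : s.reg 7 = j)
    (h11 : s.reg 11 = S) (h12 : s.reg 12 = e) :
    Expr.expandAll.eval s = CutwidthColoring.expandAll q S e (s.arr 1) j := by
  simp only [Expr.expandAll, eval_add, eval_sub, eval_mul, eval_div, eval_mod, eval_reg, eval_lit,
    eval_arr, h1, h7, h11, h12, CutwidthColoring.expandAll, State.arr]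
  have ha : j / S % (e + 1) < e + 1 := Nat.mod_lt _ (by omega)
  have hacast : (j : ℤ) / S % (e + 1) = (j / S % (e + 1) : ℕ) := by push_cast; rfl
  rw [hacast]
  generalize j / S % (e + 1) = a at *
  have hfirst : (1 : ℤ) - (a : ℤ) / e = if a < e then 1 else 0 := by
    rcases Nat.lt_or_ge a e with h | h
    · rw [if_pos h, Int.ediv_eq_zero_of_lt (by positivity) (by exact_mod_cast h)]; rfl
    · obtain rfl : a = e := by omega
      rw [if_neg (lt_irrefl _), Int.ediv_self (by positivity)]; rfl
  have hsecond : ((a : ℤ) + e) / (e + 1) = if 0 < a then 1 else 0 := by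
    rcases Nat.eq_zero_or_pos a with rfl | h
    · rw [if_neg (lt_irrefl _), Int.ediv_eq_zero_of_lt] <;> push_cast <;> linarith
    · rw [if_pos h]
      have : a + e = (a - 1) + (e + 1) * 1 := by omega
      rw [← Nat.cast_add, this, Nat.cast_add]
      have h2 : (((e + 1) * 1 : ℕ) : ℤ) = ((e : ℤ) + 1) * 1 := by push_cast; rfl
      rw [h2, Int.add_mul_ediv_left _ _ (by positivity), Int.ediv_eq_zero_of_lt (by positivity)]
      · rfl
      · exact_mod_cast (by omega : a - 1 < e + 1)
  rw [hfirst, hsecond]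
  congr 1
  · split_ifs
    · push_cast; ring_nf
    · ring
  · split_ifs with h
    · rw [one_mul]; push_cast [Nat.cast_sub h]; rfl
    · ring

theorem Tr.expand {q S e N : ℕ} {b : ℤ} (he : 0 < e) (h1 : s.reg 1 = q) (h6 : s.reg 6 = N)
    (h11 : s.reg 11 = S) (h12 : s.reg 12 = e)
    (hb : ∀ j < N, |expandAll q S e (s.arr 1) j| ≤ b) (hL : b < 2 ^ L) (hNL : N < 2 ^ L)
    (hQ : ∀ s', (∀ y, y ≠ 7 → s'.reg y = s.reg y) →
      (∀ j < N, s'.arr 1 j = expandAll q S e (s.arr 1) j) → (∀ a, 0 ≤ a → s'.mem a = s.mem a) →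
      (∀ j, s'.arr 0 j = s.arr 0 j) → (∀ j, s'.arr 3 j = s.arr 3 j) → s'.used = s.used → Q s') :
    Tr r L (1000 * N + 20) .expand s Q := by
  have hc6 : (reg 6).cost + (reg 6).width + 2 = 5 := by decide
  refine (Tr.seq (k₁ := 912 * N + 5) (k₂ := 82 * N + 5) ((Tr.fill (kb := 900)
    (F := CutwidthColoring.expandAll q S e (s.arr 1))
    ∅ 2 (by norm_num) (by decide) (by decide) (by simpa using h6) hNL ?_ ?_).mono ?_
    fun _ _ h => h)).mono (by omega) fun _ _ h => h
  · intro j hj s' _ h7 hreg hmem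
    have harr : s'.arr 1 = s.arr 1 := funext fun i =>
      hmem _ fun j _ => by rw [Ne, addr_inj (by norm_num) (by norm_num)]; omega
    refine Tr.put_val (a := addr 2 j) (v := CutwidthColoring.expandAll q S e (s.arr 1) j)
      (by decide) (by decide) (by simp [h7])
      ?_ (fun _ => len_le_iff.2 ((hb j hj).trans_lt hL)) (by decide) ⟨fun y _ => rfl, rfl, rfl⟩
    rw [← harr]
    exact eval_expandAll he ((hreg 1 (by decide)).trans h1) h7 ((hreg 11 (by decide)).trans h11)
      ((hreg 12 (by decide)).trans h12)
  · intro s₁ h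
    refine (Tr.fill (kb := 70) (F := CutwidthColoring.expandAll q S e (s.arr 1))
      ∅ 1 (by norm_num) (by decide) (by decide) (N := N) ?_ hNL ?_ ?_).mono ?_ fun _ _ h => h
    · rw [eval_reg, h.reg 6 (by decide), h6]
    · intro j hj s' _ h7 hreg hmem
      refine Tr.put_val (a := addr 1 j) (v := CutwidthColoring.expandAll q S e (s.arr 1) j)
        (by decide) (by decide) (by simp [h7])
        ?_ (fun _ => len_le_iff.2 ((hb j hj).trans_lt hL)) (by decide) ⟨fun y _ => rfl, rfl, rfl⟩
      rw [eval_arr, eval_reg, h7, hmem, h.cell j hj]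
      exact fun j _ => by rw [Ne, addr_inj (by norm_num) (by norm_num)]; omega
    · intro s₂ h'
      refine hQ s₂ (fun y hy => ?_) h'.cell (fun a ha => ?_) (fun j => ?_) (fun j => ?_) ?_
      · rw [h'.reg y (by simp [hy]), h.reg y (by simp [hy])]
      · rw [h'.nonneg ha, h.nonneg ha]
      · exact (h'.other (by norm_num) (by norm_num) (by norm_num) _).trans
          (h.other (by norm_num) (by norm_num) (by norm_num) _)
      · exact (h'.other (by norm_num) (by norm_num) (by norm_num) _).trans
          (h.other (by norm_num) (by norm_num) (by norm_num) _)
      · rw [h'.used, h.used]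
    · omega
  · omega

end CoinRAM

namespace CutwidthColoring

/-! ### The treatment of one edge -/

theorem size_mono {D D' : ℕ → ℕ} {w k : ℕ} (hw : w ≤ k) (hD : ∀ v < w, D v ≤ D' v)
    (hpos : ∀ v < k, 0 < D' v) : size D w ≤ size D' k := by
  refine (Finset.prod_le_prod' fun v hv => hD v (Finset.mem_range.1 hv)).trans ?_
  exact Finset.prod_le_prod_of_subset_of_one_le' (Finset.range_mono hw)
    fun v hv _ => hpos v (Finset.mem_range.1 hv)

theorem interleaved_lt {q c j N : ℕ} (hj : j < N) (hc : c < q) : j * q + c < q * N :=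
  calc j * q + c < (j + 1) * q := by rw [add_mul]; omega
    _ ≤ N * q := Nat.mul_le_mul_right _ hj
    _ = q * N := mul_comm _ _

/-- The radices of the table while position `p` is being treated, when the edges between `p` and the
positions from `w` on have been dealt with. -/
noncomputable def midRadix (n : ℕ) (adj : ℕ → ℕ → Prop) (p w v : ℕ) : ℕ :=
  if w ≤ v then radix n adj p v else radix n adj (p + 1) v

variable {n : ℕ} {adj : ℕ → ℕ → Prop} {p w v : ℕ}

theorem radix_succ_le (hp : p < n) : radix n adj (p + 1) v ≤ radix n adj p v := by
  rw [radix_step adj hp]; omega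

theorem midRadix_pos : 0 < midRadix n adj p w v := by
  unfold midRadix; split_ifs <;> exact radix_pos _ _ _ _

theorem midRadix_le (hp : p < n) : midRadix n adj p w v ≤ radix n adj p v := by
  unfold midRadix; split_ifs
  · exact le_rfl
  · exact radix_succ_le hp

theorem midRadix_of_lt (h : v < w) : midRadix n adj p w v = radix n adj (p + 1) v :=
  if_neg (by omega)

theorem midRadix_of_le (h : w ≤ v) : midRadix n adj p w v = radix n adj p v :=
  if_pos h

theorem midRadix_succ_of_ne (h : v ≠ w) : midRadix n adj p w v = midRadix n adj p (w + 1) v := by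
  unfold midRadix; split_ifs <;> first | rfl | omega

end CutwidthColoring

namespace CoinRAM

open CoinRAM.Expr CutwidthColoring

/-- Deal with the edge between the current position, held in register `2`, and the position in
register `10`, if there is one. -/
def Prog.absorb : Prog :=
  .seq (.assign 12 (arr 3 (reg 10))) (.seq (.assign 11 (reg 11 / reg 12))
    (.seq (.assign 14 (ld (reg 0 + reg 0 * reg 13 + ld (reg 10))))
      (.cond 14 (.seq (.assign 6 (reg 6 / reg 12 * (reg 12 + lit 1)))
        (.seq .expand (.put (arrAddr 3 (reg 10)) (reg 12 + lit 1)))) .skip)))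

open Classical in
/-- The state `s` contains the input: `vert p` is the vertex at position `p`, and the adjacency of
positions is `adj`. -/
structure Encodes (n q : ℕ) (vert : ℕ → ℕ) (adj : ℕ → ℕ → Prop) (s : State) : Prop where
  order : s.reg 0 = n
  colors : s.reg 1 = q
  vertex : ∀ p < n, s.mem p = vert p
  edge : ∀ p < n, ∀ w < n, s.mem (n + n * vert p + vert w) = if adj p w then 1 else 0

theorem Encodes.congr {n q : ℕ} {vert : ℕ → ℕ} {adj : ℕ → ℕ → Prop} {s s' : State}
    (h : Encodes n q vert adj s) (h0 : s'.reg 0 = s.reg 0) (h1 : s'.reg 1 = s.reg 1)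
    (hm : ∀ a, 0 ≤ a → s'.mem a = s.mem a) : Encodes n q vert adj s' :=
  ⟨h0.trans h.order, h1.trans h.colors,
    fun p hp => (hm _ (by positivity)).trans (h.vertex p hp),
    fun p hp w hw => (hm _ (by positivity)).trans (h.edge p hp w hw)⟩

open Classical in
/-- The invariant of the loop over the earlier positions, for the current position `p`, when its edges
to the positions from `w` on have been dealt with. The random number is `x`, the number of random
bits used is `u`, the count of the colorings of the later positions is `f`, and `b` bounds the
entries at the start of the loop. -/
structure AbsorbInv (n q : ℕ) (vert : ℕ → ℕ) (adj : ℕ → ℕ → Prop) (p : ℕ) (x : ℤ) (u : ℕ)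
    (f : (ℕ → ℤ) → ℤ) (b : ℤ) (w : ℕ) (s : State) : Prop where
  enc : Encodes n q vert adj s
  position : s.reg 2 = p
  random : s.reg 3 = x
  current : s.reg 13 = vert p
  used : s.used = u
  total : s.reg 6 = (q * size (midRadix n adj p w) p : ℕ)
  weight : s.reg 11 = (q * size (radix n adj (p + 1)) w : ℕ)
  radices : ∀ v < p, s.arr 3 v = midRadix n adj p w v
  value : ∀ c < q, ∀ z : ℕ → ℤ, tableEval (midRadix n adj p w) z p (fun j => s.arr 1 (j * q + c))
    = (∏ v ∈ Finset.Ico w p with adj p v, ((c : ℤ) - z v)) * f (Function.update z p c)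
  bound : ∀ j < q * size (midRadix n adj p w) p, |s.arr 1 j| ≤ b * n ^ (p - w)

variable {r : ℕ → Bool} {L k : ℕ} {s : State} {Q : State → Prop}

theorem State.arr_setReg (s : State) (x : ℕ) (a : ℤ) (k : ℕ) : (s.setReg x a).arr k = s.arr k := rfl

theorem State.arr_setMem (s : State) {k k' : ℕ} (hk : k < 4) (hk' : k' < 4) (i : ℕ) (a : ℤ) (j : ℕ) :
    (s.setMem (addr k i) a).arr k' j = if k' = k ∧ j = i then a else s.arr k' j := by
  rw [State.arr, State.setMem_mem, State.arr]
  simp only [addr_inj hk' hk, Nat.cast_inj]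

/-- `absorb` takes the invariant from `w + 1` to `w`, in time linear in the bound `K` on the table
size. -/
theorem Tr.absorb {n q p w u K : ℕ} {vert : ℕ → ℕ} {adj : ℕ → ℕ → Prop} {x b : ℤ}
    {f : (ℕ → ℤ) → ℤ} (hq : 0 < q) (hqn : q < n) (hp : p < n) (hw : w < p) (hb : 0 ≤ b)
    (hK : q * size (radix n adj p) p ≤ K) (hKL : q * size (radix n adj p) p < 2 ^ L)
    (hnL : n < 2 ^ L) (hbL : b * n ^ n < 2 ^ L) (h10 : s.reg 10 = w)
    (hs : AbsorbInv n q vert adj p x u f b (w + 1) s) :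
    Tr r L (1000 * K + 200) .absorb s
      fun s' => s'.reg 10 = w ∧ AbsorbInv n q vert adj p x u f b w s' := by
  have hn1 : 1 ≤ n := by omega
  set e := radix n adj (p + 1) w with he
  set S := size (radix n adj (p + 1)) w with hS
  have he0 : 0 < e := radix_pos _ _ _ _
  have hen : e + 1 ≤ n := by have := radix_le n adj (p + 1) w; omega
  have hSS : size (radix n adj (p + 1)) (w + 1) = S * e := size_succ _ _
  have hSmid : size (midRadix n adj p (w + 1)) w = S :=
    size_congr fun v hv => midRadix_of_lt (by omega)
  have hemid : midRadix n adj p (w + 1) w = e := midRadix_of_lt (by omega)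
  have hsizes : ∀ w', size (midRadix n adj p w') p ≤ size (radix n adj p) p := fun w' =>
    size_mono le_rfl (fun v _ => midRadix_le hp) fun v _ => radix_pos _ _ _ _
  have hSle : S ≤ size (radix n adj p) p :=
    size_mono hw.le (fun v _ => radix_succ_le hp) fun v _ => radix_pos _ _ _ _
  have h1L : 1 ≤ L := by
    rcases Nat.eq_zero_or_pos L with rfl | h
    · simp at hnL; omega
    · exact h
  have hlen1 : len 1 ≤ L := h1L
  refine (Tr.seq (k₁ := 40) (k₂ := 1000 * K + 160) (Tr.assign_val (v := e) (by norm_num)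
    (by decide) ?_ (len_natCast_le (by omega)) (by decide) ?_)).mono (by omega) fun _ _ h => h
  · rw [eval_arr, eval_reg, h10]
    exact (hs.radices w hw).trans (by rw [hemid])
  refine (Tr.seq (k₁ := 10) (k₂ := 1000 * K + 150) (Tr.assign_val (v := (q * S : ℕ)) (by norm_num)
    (by decide) ?_ (len_natCast_le ((Nat.mul_le_mul_left _ hSle).trans_lt hKL)) (by decide)
    ?_)).mono (by omega) fun _ _ h => h
  · simp only [eval_div, eval_reg, State.setReg_reg]
    norm_num
    rw [hs.weight, hSS, ← mul_assoc, ← Int.natCast_div, Nat.mul_div_cancel _ he0]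
    push_cast; rfl
  classical
  refine (Tr.seq (k₁ := 30) (k₂ := 1000 * K + 120) (Tr.assign_val
    (v := if adj p w then 1 else 0) (by norm_num) (by decide) ?_ ?_ (by decide)
    ?_)).mono (by omega) fun _ _ h => h
  · simp only [eval_ld, eval_add, eval_mul, eval_reg, State.setReg_reg, State.setReg_mem]
    norm_num
    rw [h10, hs.enc.vertex w (by omega), hs.enc.order, hs.current, hs.enc.edge p hp w (by omega)]
  · split_ifs
    · exact hlen1
    · simp [len_zero]
  have hprod : ∀ (c : ℕ) (z : ℕ → ℤ), (∏ v ∈ Finset.Ico w p with adj p v, ((c : ℤ) - z v))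
      = (if adj p w then (c : ℤ) - z w else 1) *
        ∏ v ∈ Finset.Ico (w + 1) p with adj p v, ((c : ℤ) - z v) := by
    intro c z
    rw [← Finset.insert_Ico_add_one_left_eq_Ico hw, Finset.filter_insert]
    split_ifs
    · rw [Finset.prod_insert (by simp)]
    · rw [one_mul]
  have hpw : p - w = p - (w + 1) + 1 := by omega
  have hbmono : b * (n : ℤ) ^ (p - (w + 1)) ≤ b * n ^ (p - w) :=
    mul_le_mul_of_nonneg_left (pow_le_pow_right₀ (by exact_mod_cast hn1) (by omega)) hb
  refine (Tr.cond (k := 1000 * K + 100) (by norm_num) (fun h14 => ?_) (fun h14 => ?_)).mono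
    (by omega) fun _ _ h => h
  · -- the edge is present
    have hadj : adj p w := by
      by_contra h
      simp [h] at h14
    have hstep : midRadix n adj p w w = e + 1 := by
      rw [midRadix_of_le le_rfl, radix_step adj hp, if_pos hadj]
    obtain ⟨H, hH, hH'⟩ := exists_size_eq (D := midRadix n adj p (w + 1))
      (D' := midRadix n adj p w) hw (by rw [hstep, hemid]) fun v _ hv => midRadix_succ_of_ne hv
    rw [hSmid, hemid] at hH hH'
    refine (Tr.seq (k₁ := 30) (k₂ := 1000 * K + 70) (Tr.assign_val
      (v := (q * size (midRadix n adj p w) p : ℕ)) (by norm_num) (by decide) ?_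
      (len_natCast_le ((Nat.mul_le_mul_left _ (hsizes w)).trans_lt hKL)) (by decide)
      ?_)).mono (by omega) fun _ _ h => h
    · simp only [eval_div, eval_mul, eval_add, eval_lit, eval_reg, State.setReg_reg]
      norm_num
      rw [hs.total, hH, hH', show q * (S * e * H) = q * S * H * e by ring, ← Int.natCast_div,
        Nat.mul_div_cancel _ he0]
      push_cast; ring
    have hbd : ∀ j < q * size (midRadix n adj p w) p,
        |expandAll q (q * S) e (s.arr 1) j| ≤ b * n ^ (p - w) := by
      intro j hj
      refine (abs_expandAll_le (N := H) hq he0 (b := b * n ^ (p - (w + 1))) (fun j hj => ?_) ?_).trans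
        ?_
      · refine hs.bound j ?_
        rw [hH]; convert hj using 1; ring
      · rw [hH'] at hj; convert hj using 1; ring
      · rw [hpw, pow_succ]
        have h1 : (q : ℤ) + 1 ≤ n := by exact_mod_cast hqn
        have h2 : 0 ≤ b * (n : ℤ) ^ (p - (w + 1)) := by positivity
        nlinarith
    refine (Tr.seq (k₁ := 1000 * K + 20) (k₂ := 50) ((Tr.expand (q := q) (S := q * S) (e := e)
      (N := q * size (midRadix n adj p w) p) (b := b * n ^ (p - w)) he0 ?_ ?_ ?_ ?_ (by exact hbd) ?_
      ((Nat.mul_le_mul_left _ (hsizes w)).trans_lt hKL) ?_).mono ?_ fun _ _ h => h)).mono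
      (by omega) fun _ _ h => h
    · simpa using hs.enc.colors
    · simp
    · simp
    · simp
    · refine lt_of_le_of_lt (mul_le_mul_of_nonneg_left (pow_le_pow_right₀ ?_ ?_) hb) hbL
      · exact_mod_cast hn1
      · omega
    · intro s' hreg harr hmem harr0 harr3 hused
      have h12 : s'.reg 12 = e := by rw [hreg 12 (by norm_num)]; simp
      have h10' : s'.reg 10 = w := by rw [hreg 10 (by norm_num)]; simpa using h10
      refine Tr.put_val (a := addr 3 w) (v := (e + 1 : ℕ)) (by decide) (by decide) (by simp [h10'])
        (by simp [h12]) (fun _ => len_natCast_le (by omega)) (by decide) ⟨h10', ?_⟩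
      have hcell : ∀ k' < 3, ∀ j, (s'.setMem (addr 3 w) (e + 1 : ℕ)).arr k' j = s'.arr k' j := by
        intro k' hk' j
        rw [State.arr_setMem _ (by norm_num) (by omega), if_neg (by omega)]
      refine ⟨?_, ?_, ?_, ?_, ?_, ?_, ?_, fun v hv => ?_, fun c hc z => ?_, fun j hj => ?_⟩
      · refine hs.enc.congr ?_ ?_ fun a ha => ?_
        · rw [State.setMem_reg, hreg 0 (by norm_num)]; simp
        · rw [State.setMem_reg, hreg 1 (by norm_num)]; simp
        · rw [State.setMem_mem, if_neg (ne_addr ha 3 w), hmem a ha]; rfl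
      · rw [State.setMem_reg, hreg 2 (by norm_num)]; simpa using hs.position
      · rw [State.setMem_reg, hreg 3 (by norm_num)]; simpa using hs.random
      · rw [State.setMem_reg, hreg 13 (by norm_num)]; simpa using hs.current
      · rw [State.setMem_used, hused]; simpa using hs.used
      · rw [State.setMem_reg, hreg 6 (by norm_num)]; simp
      · rw [State.setMem_reg, hreg 11 (by norm_num)]; simp [hS]
      · rw [State.arr_setMem _ (by norm_num) (by norm_num)]
        by_cases hvw : v = w
        · rw [if_pos ⟨rfl, hvw⟩, hvw, hstep]
        · rw [if_neg (by tauto), harr3, midRadix_succ_of_ne hvw]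
          exact hs.radices v hv
      · rw [hprod, if_pos hadj, mul_assoc, ← hs.value c hc z, ← tableEval_expand z c
          (fun j => s.arr 1 (j * q + c)) hw (fun v _ => midRadix_pos) (by rw [hstep, hemid])
          fun v _ hv => midRadix_succ_of_ne hv, hSmid, hemid]
        refine tableEval_congr (fun _ _ => rfl) (fun _ _ => rfl) fun j hj => ?_
        rw [hcell 1 (by norm_num), harr _ (interleaved_lt hj hc)]
        exact expandAll_interleaved hc S e (s.arr 1) j
      · rw [hcell 1 (by norm_num), harr j hj]
        exact hbd j hj
    · have := (Nat.mul_le_mul_left q (hsizes w)).trans hK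
      omega
  · -- there is no edge
    have hadj : ¬ adj p w := by
      intro h
      simp [h] at h14
    have hstep : ∀ v, midRadix n adj p w v = midRadix n adj p (w + 1) v := by
      intro v
      by_cases hvw : v = w
      · rw [hvw, midRadix_of_le le_rfl, hemid, radix_step adj hp, if_neg hadj,
          add_zero, he]
      · exact midRadix_succ_of_ne hvw
    have hfun : midRadix n adj p w = midRadix n adj p (w + 1) := funext hstep
    refine (Tr.skip ⟨by simpa using h10, hs.enc.congr (by simp) (by simp) (fun _ _ => rfl),
      by simpa using hs.position, by simpa using hs.random, by simpa using hs.current,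
      by simpa using hs.used, ?_, by simp [hS], ?_, ?_, ?_⟩).mono (by omega) fun _ _ h => h
    · rw [hfun]; simpa using hs.total
    · rw [hfun]; exact hs.radices
    · intro c hc z
      have h := hprod c z
      rw [if_neg hadj, one_mul] at h
      rw [hfun, h]
      exact hs.value c hc z
    · intro j hj
      rw [hfun] at hj
      exact (hs.bound j hj).trans hbmono

end CoinRAM

namespace CutwidthColoring

/-! ### The treatment of one vertex -/

theorem size_radix_le (n : ℕ) (adj : ℕ → ℕ → Prop) {p : ℕ} (hp : p ≤ n) :
    size (radix n adj p) p ≤ n ^ n := by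
  rcases Nat.eq_zero_or_pos p with rfl | hp0
  · rcases Nat.eq_zero_or_pos n with rfl | hn
    · simp [size]
    · simpa [size] using Nat.one_le_pow _ _ hn
  · calc size (radix n adj p) p ≤ ∏ _w ∈ Finset.range p, n := Finset.prod_le_prod' fun w _ => by
          have := radix_le n adj p w; omega
      _ = n ^ p := by simp
      _ ≤ n ^ n := Nat.pow_le_pow_right (by omega) hp

/-- The factor by which the entries of the table may grow while one vertex is treated: `contract`,
at most `n` times `expandAll`, and `collapse`. -/
def stepFactor (n : ℕ) : ℕ := n * n ^ n * n ^ n * (n * (2 ^ (3 * n + 1)) ^ n)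

end CutwidthColoring

namespace CoinRAM

open CoinRAM.Expr CutwidthColoring

/-- Deal with the position in register `2`. -/
def Prog.vertex : Prog :=
  .seq (.assign 13 (ld (reg 2))) (.seq .draw (.seq (.assign 18 (arr 3 (reg 2)))
    (.seq (.assign 16 (reg 6 / reg 18)) (.seq (.assign 6 (reg 1 * reg 16))
    (.seq (.assign 11 (reg 6)) (.seq .contract (.seq (.forDown 10 (reg 2) .absorb)
    (.seq (.assign 6 (reg 6 / reg 1)) (.seq (.assign 16 (lit 1)) (.seq (.assign 17 (reg 3))
    (.seq (.assign 18 (reg 1)) .collapse)))))))))))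

/-- The random weight of position `p`. The positions are treated in decreasing order. -/
def weight (r : ℕ → Bool) (n p : ℕ) : ℤ := bitsValue r ((n - (p + 1)) * (3 * n + 1)) (3 * n + 1)

/-- The invariant of the loop over all positions, when the positions from `p` on have been dealt
with. -/
structure VertexInv (r : ℕ → Bool) (n q : ℕ) (vert : ℕ → ℕ) (adj : ℕ → ℕ → Prop) (p : ℕ)
    (s : State) : Prop where
  enc : Encodes n q vert adj s
  used : s.used = (n - p) * (3 * n + 1)
  total : s.reg 6 = size (radix n adj p) p
  radices : ∀ w < p, s.arr 3 w = radix n adj p w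
  value : ∀ z : ℕ → ℤ, tableEval (radix n adj p) z p (s.arr 0)
    = suffixCount n q adj (weight r n) (n - p) z
  bound : ∀ j < size (radix n adj p) p, |s.arr 0 j| ≤ (stepFactor n : ℤ) ^ (n - p)

variable {r : ℕ → Bool} {L k : ℕ} {s : State} {Q : State → Prop}

set_option maxHeartbeats 400000 in
/-- `vertex` takes the invariant from `p + 1` to `p`. Here `K` bounds the table size, and the
hypothesis `hL` says that all numbers that can occur have at most `L` bits. -/
theorem Tr.vertex {n q p K : ℕ} {vert : ℕ → ℕ} {adj : ℕ → ℕ → Prop} (hq : 0 < q) (hqn : q < n)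
    (hp : p < n) (hvert : ∀ p < n, vert p < n) (hK : q * size (radix n adj p) p ≤ K)
    (hL : stepFactor n ^ (n + 1) < 2 ^ L) (h2 : s.reg 2 = p)
    (hs : VertexInv r n q vert adj (p + 1) s) :
    Tr r L (2000 * ((n + 1) * (K + 1))) .vertex s
      fun s' => s'.reg 2 = p ∧ VertexInv r n q vert adj p s' := by
  -- bounds on the numbers that occur
  set F := stepFactor n with hF
  set X : ℕ := 2 ^ (3 * n + 1) with hX
  set kk := n - (p + 1) with hkk
  have hkp : n - p = kk + 1 := by omega
  have hn1 : 1 ≤ n := by omega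
  have hX1 : 1 ≤ X := Nat.one_le_two_pow
  have hnn1 : 1 ≤ n ^ n := Nat.one_le_pow _ _ hn1
  have hXn1 : 1 ≤ X ^ n := Nat.one_le_pow _ _ hX1
  have hFeq : F = n * n ^ n * n ^ n * (n * X ^ n) := rfl
  have hF1 : 1 ≤ F := by rw [hFeq]; exact Nat.mul_pos (by positivity) (by positivity)
  have hFL : F < 2 ^ L := (Nat.le_self_pow (by omega) F).trans_lt hL
  have hFkL : F ^ (kk + 1) < 2 ^ L := (Nat.pow_le_pow_right hF1 (by omega)).trans_lt hL
  have hnF : n * n ^ n ≤ F := by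
    rw [hFeq, mul_assoc]
    exact Nat.le_mul_of_pos_right _ (Nat.mul_pos hnn1 (Nat.mul_pos hn1 hXn1))
  have hnL : n < 2 ^ L := ((Nat.le_mul_of_pos_right n hnn1).trans hnF).trans_lt hFL
  have hqL : q < 2 ^ L := hqn.trans hnL
  have hXL : X < 2 ^ L := by
    refine lt_of_le_of_lt ?_ hFL
    calc X ≤ X ^ n := Nat.le_self_pow (by omega) X
      _ ≤ n * X ^ n := Nat.le_mul_of_pos_left _ hn1
      _ ≤ F := Nat.le_mul_of_pos_left _ (by positivity)
  have hmL : 3 * n + 1 < L := (Nat.pow_lt_pow_iff_right (by norm_num : 1 < 2)).1 hXL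
  have hqsize : q * size (radix n adj p) p < 2 ^ L :=
    ((Nat.mul_le_mul hqn.le (size_radix_le n adj hp.le)).trans hnF).trans_lt hFL
  set R := size (radix n adj (p + 1)) p with hR
  set S := size (radix n adj p) p with hS
  set e := radix n adj (p + 1) p with he
  have he0 : 0 < e := radix_pos _ _ _ _
  have hen : e ≤ n := by have := radix_le n adj (p + 1) p; omega
  have hRS : R ≤ S := size_mono le_rfl (fun v _ => radix_succ_le hp) fun v _ => radix_pos _ _ _ _
  have hqR : q * R ≤ q * S := Nat.mul_le_mul_left _ hRS
  have hRq : R ≤ q * R := Nat.le_mul_of_pos_left _ hq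
  have hSq : S ≤ q * S := Nat.le_mul_of_pos_left _ hq
  have hRe : size (radix n adj (p + 1)) (p + 1) = R * e := size_succ _ _
  set b : ℤ := (n : ℤ) * n ^ n * F ^ kk with hb
  have hb0 : 0 ≤ b := by positivity
  have hbn : b * n ^ n * (n * X ^ n) = F ^ (kk + 1) := by
    rw [hb, pow_succ, hFeq]; push_cast; ring
  have hbnF : b * n ^ n ≤ (F : ℤ) ^ (kk + 1) := by
    rw [← hbn]
    refine le_mul_of_one_le_right (by positivity) ?_
    exact_mod_cast Nat.mul_pos hn1 hXn1
  have hFkLz : (F : ℤ) ^ (kk + 1) < 2 ^ L := by exact_mod_cast hFkL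
  have hbnL : b * n ^ n < 2 ^ L := hbnF.trans_lt hFkLz
  have hn1z : (1 : ℤ) ≤ n := by exact_mod_cast hn1
  have hqnz : (q : ℤ) ≤ n := by exact_mod_cast hqn.le
  have hcon : e * ((q : ℤ) ^ e * (F : ℤ) ^ kk) ≤ b := by
    rw [hb, ← mul_assoc]
    refine mul_le_mul_of_nonneg_right (mul_le_mul (by exact_mod_cast hen) ?_ (by positivity)
      (by positivity)) (by positivity)
    exact (pow_le_pow_left₀ (by positivity) hqnz e).trans (pow_le_pow_right₀ hn1z hen)
  -- the program
  refine (Tr.seq (k₁ := 20) (k₂ := 2000 * ((n + 1) * (K + 1)) - 20) (Tr.assign_val (v := vert p)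
    (by norm_num) (by decide) ?_ (len_natCast_le ((hvert p hp).trans hnL)) (by decide) ?_)).mono ?_
    fun _ _ h => h
  · rw [eval_ld, eval_reg, h2, hs.enc.vertex p hp]
  rotate_left
  · have : 20 ≤ 2000 * ((n + 1) * (K + 1)) := by nlinarith [Nat.zero_le (n * K)]
    omega
  set C := (80 * n + 110) * K + ((1000 * K + 212) * n + ((80 * n + 100) * K)) + 130 with hC
  have htime : 50 * (3 * n + 1) + 50 + (100 + C) ≤ 2000 * ((n + 1) * (K + 1)) - 20 := by
    have h1 : 2000 * ((n + 1) * (K + 1)) = 2000 * (n * K) + 2000 * n + 2000 * K + 2000 := by ring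
    have h2 : C = 1160 * (n * K) + 210 * K + 212 * n + 130 := by rw [hC]; ring
    omega
  refine (Tr.seq (k₁ := 50 * (3 * n + 1) + 50) (k₂ := 100 + C) (Tr.draw hmL
    (by simpa using hs.enc.order) ?_)).mono htime fun _ _ h => h
  intro s₁ hreg₁ hmem₁ hused₁ h3₁
  have hu : (s.setReg 13 (vert p)).used = kk * (3 * n + 1) := by rw [State.setReg_used, hs.used]
  have h3₁' : s₁.reg 3 = weight r n p := by rw [h3₁, hu]; rfl
  have hu₁ : s₁.used = (n - p) * (3 * n + 1) := by rw [hused₁, hu, hkp, add_mul, one_mul]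
  have harr₁ : s₁.arr = s.arr := by funext k j; rw [State.arr, hmem₁]; rfl
  have h13₁ : s₁.reg 13 = vert p := by rw [hreg₁ 13 (by decide)]; simp
  have h2₁ : s₁.reg 2 = p := by rw [hreg₁ 2 (by decide)]; simpa using h2
  have h6₁ : s₁.reg 6 = (R * e : ℕ) := by
    rw [hreg₁ 6 (by decide)]; simp only [State.setReg_reg]; norm_num; rw [hs.total, hRe]; push_cast; rfl
  have henc₁ : Encodes n q vert adj s₁ := hs.enc.congr (by rw [hreg₁ 0 (by decide)]; simp)
    (by rw [hreg₁ 1 (by decide)]; simp) fun a _ => by rw [hmem₁]; rfl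
  clear hreg₁ hused₁ h3₁ hmem₁
  refine (Tr.seq (k₁ := 40) (k₂ := 60 + C) (Tr.assign_val (v := e) (by norm_num) (by decide) ?_
    (len_natCast_le (hen.trans_lt hnL)) (by decide) ?_)).mono (by omega) fun _ _ h => h
  · rw [eval_arr, eval_reg, h2₁]
    change s₁.arr 3 p = _
    rw [harr₁, hs.radices p (by omega)]
  refine (Tr.seq (k₁ := 10) (k₂ := 50 + C) (Tr.assign_val (v := R) (by norm_num) (by decide) ?_
    (len_natCast_le (by omega)) (by decide) ?_)).mono (by omega) fun _ _ h => h
  · simp only [eval_div, eval_reg, State.setReg_reg]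
    norm_num
    rw [h6₁, ← Int.natCast_div, Nat.mul_div_cancel _ he0]
  refine (Tr.seq (k₁ := 10) (k₂ := 40 + C) (Tr.assign_val (v := (q * R : ℕ)) (by norm_num)
    (by decide) ?_ (len_natCast_le (by omega)) (by decide) ?_)).mono (by omega) fun _ _ h => h
  · simp [henc₁.colors]
  refine (Tr.seq (k₁ := 10) (k₂ := 30 + C) (Tr.assign_val (v := (q * R : ℕ)) (by norm_num)
    (by decide) (by simp) (len_natCast_le (by omega)) (by decide) ?_)).mono (by omega)
    fun _ _ h => h
  refine (Tr.seq (k₁ := (80 * e + 110) * (q * R) + 10)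
    (k₂ := (1000 * K + 212) * n + ((80 * n + 100) * K) + 140)
    (Tr.contract (q := q) (R := R) (e := e) (b := (F : ℤ) ^ kk) hq ?_ ?_ ?_ ?_ (by positivity) ?_
      (hen.trans_lt hnL) (by omega) ?_ hqL ?_)).mono ?_ fun _ _ h => h
  · simpa using henc₁.colors
  · simp
  · simp
  · simp
  · intro j hj
    rw [← hRe] at hj
    have := hs.bound j hj
    simpa only [State.arr_setReg, harr₁] using this
  · refine lt_of_le_of_lt (hcon.trans ?_) hbnL
    exact le_mul_of_one_le_right hb0 (by exact_mod_cast hnn1)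
  rotate_left
  · have h1 : (80 * e + 110) * (q * R) ≤ (80 * n + 110) * K :=
      Nat.mul_le_mul (by omega) (hqR.trans hK)
    omega
  intro s₂ hs₂
  simp only [State.arr_setReg, harr₁] at hs₂
  have henc₂ : Encodes n q vert adj s₂ := henc₁.congr (by rw [hs₂.reg 0 (by decide)]; simp)
    (by rw [hs₂.reg 1 (by decide)]; simp) fun a ha => by rw [hs₂.nonneg ha]; rfl
  -- the part of the program after the loop over the earlier positions
  have hfin : ∀ s₃ : State, AbsorbInv n q vert adj p (weight r n p) ((n - p) * (3 * n + 1))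
      (suffixCount n q adj (weight r n) kk) b 0 s₃ →
      Tr r L ((80 * n + 100) * K + 120) (.seq (.assign 6 (reg 6 / reg 1))
        (.seq (.assign 16 (lit 1)) (.seq (.assign 17 (reg 3)) (.seq (.assign 18 (reg 1)) .collapse))))
      s₃ fun s' => s'.reg 2 = p ∧ VertexInv r n q vert adj p s' := by
    intro s₃ hs₃
    have hmid : midRadix n adj p 0 = radix n adj p := funext fun v => midRadix_of_le (Nat.zero_le v)
    have hw0 : 0 ≤ weight r n p := by unfold weight; positivity
    have hwX : weight r n p < X := by unfold weight; exact_mod_cast bitsValue_lt _ _ _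
    have hSL : S < 2 ^ L := by omega
    have hb1 : (0 : ℤ) ≤ b * n ^ p := by positivity
    have hbp : b * (n : ℤ) ^ p ≤ b * n ^ n :=
      mul_le_mul_of_nonneg_left (pow_le_pow_right₀ hn1z hp.le) hb0
    have hXz : (1 : ℤ) ≤ X := by exact_mod_cast hX1
    have hcol : q * ((X : ℤ) ^ q * (b * n ^ p)) ≤ (F : ℤ) ^ (kk + 1) := by
      rw [← hbn, mul_comm (b * (n : ℤ) ^ n), mul_assoc (n : ℤ)]
      exact mul_le_mul hqnz (mul_le_mul (pow_le_pow_right₀ hXz hqn.le) hbp hb1 (by positivity))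
        (by positivity) (by positivity)
    have hbnd : ∀ j < q * S, |s₃.arr 1 j| ≤ b * n ^ p := fun j hj =>
      hs₃.bound j (by rw [hmid]; exact hj)
    refine (Tr.seq (k₁ := 10) (k₂ := (80 * n + 100) * K + 110) (Tr.assign_val (v := S) (by norm_num)
      (by decide) ?_ (len_natCast_le hSL) (by decide) ?_)).mono (by omega) fun _ _ h => h
    · rw [eval_div, eval_reg, eval_reg, hs₃.total, hs₃.enc.colors, hmid, ← Int.natCast_div,
        Nat.mul_div_cancel_left _ hq]
    refine (Tr.seq (k₁ := 10) (k₂ := (80 * n + 100) * K + 100) (Tr.assign_val (v := (1 : ℕ))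
      (by norm_num) (by decide) (by simp) (len_natCast_le (by omega)) (by decide) ?_)).mono
      (by omega) fun _ _ h => h
    refine (Tr.seq (k₁ := 10) (k₂ := (80 * n + 100) * K + 90) (Tr.assign_val (v := weight r n p)
      (by norm_num) (by decide) (by simpa using hs₃.random) ?_ (by decide) ?_)).mono
      (by omega) fun _ _ h => h
    · rw [len_le_iff, abs_of_nonneg hw0]
      exact hwX.trans (by exact_mod_cast hXL)
    refine (Tr.seq (k₁ := 10) (k₂ := (80 * n + 100) * K + 80) (Tr.assign_val (v := q)
      (by norm_num) (by decide) (by simpa using hs₃.enc.colors) (len_natCast_le hqL) (by decide)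
      ?_)).mono (by omega) fun _ _ h => h
    refine (Tr.collapse (q := q) (S := S) (x := weight r n p) (X := X) (b := b * n ^ p) hXz
      (by rw [abs_of_nonneg hw0]; exact hwX.le) ?_ ?_ ?_ ?_ ?_ hb1 (by exact hbnd) hqsize hSL
      (hcol.trans_lt hFkLz) hqL ?_).mono ?_ fun _ _ h => h
    · simpa using hs₃.enc.colors
    · simp
    · simp
    · simp
    · simp
    · intro s₄ hs₄
      simp only [State.arr_setReg] at hs₄
      refine ⟨?_, hs₃.enc.congr ?_ ?_ fun a ha => ?_, ?_, ?_, fun w hw => ?_, fun z => ?_,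
        fun j hj => ?_⟩
      · rw [hs₄.reg 2 (by decide)]; simpa using hs₃.position
      · rw [hs₄.reg 0 (by decide)]; simp
      · rw [hs₄.reg 1 (by decide)]; simp
      · rw [hs₄.nonneg ha]; rfl
      · rw [hs₄.used]; exact hs₃.used
      · rw [hs₄.reg 6 (by decide)]; simp [hS]
      · rw [State.arr, hs₄.other (by norm_num) (by norm_num) (by norm_num)]
        have := hs₃.radices w hw
        rw [hmid] at this
        exact this
      · rw [suffixCount_step adj _ hp, ← hkk]
        refine (tableEval_congr (fun _ _ => rfl) (fun _ _ => rfl)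
          fun j hj => hs₄.cell j hj).trans ?_
        rw [tableEval_collapse]
        refine Finset.sum_congr rfl fun c hc => ?_
        have := hs₃.value c (Finset.mem_range.1 hc) z
        rw [hmid, ← Finset.range_eq_Ico] at this
        rw [this]
      · rw [State.arr, hs₄.cell j hj, hkp]
        exact (abs_sum_mul_pow_le hXz (by rw [abs_of_nonneg hw0]; exact hwX.le) hb1
          (fun c hc => hbnd _ (interleaved_lt hj hc)) le_rfl).trans hcol
    · have : (80 * q + 100) * S ≤ (80 * n + 100) * K :=
        Nat.mul_le_mul (by omega) (hSq.trans hK)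
      omega
  have hmidS : size (midRadix n adj p p) p = R :=
    size_congr fun v hv => midRadix_of_lt hv
  refine (Tr.seq (k₁ := (1000 * K + 212) * n + 20) (k₂ := (80 * n + 100) * K + 120)
    ((Tr.forDown (k := 1000 * K + 200) (N := p) (AbsorbInv n q vert adj p (weight r n p)
      ((n - p) * (3 * n + 1)) (suffixCount n q adj (weight r n) kk) b) (by norm_num) (by decide)
      ?_ (hp.trans hnL) ?_ ?_).mono ?_ fun s₃ _ h => hfin s₃ h.2)).mono (by omega) fun _ _ h => h
  · rw [eval_reg, hs₂.reg 2 (by decide)]; simpa using h2₁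
  · refine ⟨henc₂.congr (by simp) (by simp) fun _ _ => rfl, ?_, ?_, ?_, ?_, ?_, ?_, fun v hv => ?_,
      fun c hc z => ?_, fun j hj => ?_⟩
    · simp only [State.setReg_reg]; norm_num
      rw [hs₂.reg 2 (by decide)]; simpa using h2₁
    · simp only [State.setReg_reg]; norm_num
      rw [hs₂.reg 3 (by decide)]; simpa using h3₁'
    · simp only [State.setReg_reg]; norm_num
      rw [hs₂.reg 13 (by decide)]; simpa using h13₁
    · rw [State.setReg_used, hs₂.used]; simpa using hu₁
    · simp only [State.setReg_reg]; norm_num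
      rw [hs₂.reg 6 (by decide), hmidS]; simp
    · simp only [State.setReg_reg]; norm_num
      rw [hs₂.reg 11 (by decide)]; simp [hR]
    · rw [State.arr_setReg, State.arr, hs₂.other (by norm_num) (by norm_num) (by norm_num),
        midRadix_of_lt hv, ← hs.radices v (by omega), ← harr₁]
      rfl
    · rw [Finset.Ico_self, Finset.filter_empty, Finset.prod_empty, one_mul, ← hs.value,
        ← tableEval_contract hc]
      refine tableEval_congr (fun v hv => midRadix_of_lt hv) (fun _ _ => rfl) fun j hj => ?_
      rw [hmidS] at hj
      rw [State.arr_setReg, State.arr, hs₂.cell _ (interleaved_lt hj hc)]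
    · rw [hmidS] at hj
      rw [State.arr_setReg, State.arr, hs₂.cell _ hj, Nat.sub_self, pow_zero, mul_one]
      refine (abs_sum_mul_pow_le (by exact_mod_cast hq) ?_ (by positivity) (fun a ha => ?_)
        le_rfl).trans hcon
      · rw [Nat.abs_cast]; exact_mod_cast (Nat.mod_lt j hq).le
      · refine hs.bound _ ?_
        rw [hRe]
        have : j / q < R := by rw [Nat.div_lt_iff_lt_mul hq]; linarith [mul_comm q R]
        rw [add_comm]
        exact interleaved_lt ha this
  · intro w hw s' _ _ hinv
    have hinv' : AbsorbInv n q vert adj p (weight r n p) ((n - p) * (3 * n + 1))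
        (suffixCount n q adj (weight r n) kk) b (w + 1) (s'.setReg 10 w) :=
      ⟨hinv.enc.congr (by simp) (by simp) fun _ _ => rfl, by simpa using hinv.position,
        by simpa using hinv.random, by simpa using hinv.current, hinv.used,
        by simpa using hinv.total, by simpa using hinv.weight, hinv.radices, hinv.value,
        hinv.bound⟩
    exact Tr.absorb hq hqn hp hw hb0 hK hqsize hnL hbnL (by simp) hinv'
  · have h1 : (1000 * K + 200 + 12) * p ≤ (1000 * K + 212) * n := Nat.mul_le_mul_left _ hp.le
    have h2 : (reg 2).cost + (reg 2).width + 2 = 5 := by decide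
    omega

end CoinRAM

namespace CutwidthColoring

/-! ### The program -/

theorem tableEval_of_radix_eq_one {D : ℕ → ℕ} (z : ℕ → ℤ) {k : ℕ} (hD : ∀ w < k, D w = 1)
    (T : ℕ → ℤ) : tableEval D z k T = T 0 := by
  induction k generalizing T with
  | zero => rfl
  | succ k ih =>
    rw [tableEval, hD k (by omega), Finset.sum_range_one, ih (fun w hw => hD w (by omega))]
    simp

theorem size_radix_self (n : ℕ) (adj : ℕ → ℕ → Prop) (k : ℕ) : size (radix n adj n) k = 1 :=
  Finset.prod_eq_one fun w _ => radix_self n adj w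

theorem stepFactor_le (n : ℕ) : stepFactor n ≤ 2 ^ (5 * n ^ 2 + 3 * n) := by
  have h : n ≤ 2 ^ n := Nat.lt_two_pow_self.le
  calc stepFactor n
      ≤ 2 ^ n * (2 ^ n) ^ n * (2 ^ n) ^ n * (2 ^ n * (2 ^ (3 * n + 1)) ^ n) := by
        unfold stepFactor; gcongr
    _ = 2 ^ (5 * n ^ 2 + 3 * n) := by
        simp only [← pow_mul, ← pow_add]; congr 1; ring

theorem stepFactor_pow_lt (n L : ℕ) (hL : 10 * (n + 1) ^ 3 ≤ L) :
    (stepFactor n ^ (n + 1)) ^ 2 < 2 ^ L := by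
  calc (stepFactor n ^ (n + 1)) ^ 2 ≤ ((2 ^ (5 * n ^ 2 + 3 * n)) ^ (n + 1)) ^ 2 := by
        gcongr; exact stepFactor_le n
    _ = 2 ^ ((5 * n ^ 2 + 3 * n) * (n + 1) * 2) := by rw [← pow_mul, ← pow_mul, mul_assoc]
    _ < 2 ^ L := Nat.pow_lt_pow_right (by norm_num) (by nlinarith)

end CutwidthColoring

namespace CoinRAM

open CoinRAM.Expr CutwidthColoring

/-- The program for the case that there are fewer colors than vertices, and at least one color.
Tests are for positivity, so the final value is squared. -/
def Prog.solve : Prog :=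
  .seq (.forDown 7 (reg 0) (.put (arrAddr 3 (reg 7)) (lit 1)))
    (.seq (.put (arrAddr 0 (lit 0)) (lit 1)) (.seq (.assign 6 (lit 1))
    (.seq (.forDown 2 (reg 0) .vertex)
    (.seq (.assign 3 (arr 0 (lit 0) * arr 0 (lit 0)))
    (.cond 3 (.assign 0 (lit 1)) (.assign 0 (lit 0)))))))

/-- The program that decides colorability. It answers "yes" if `q - n + 1 > 0`, and otherwise "no" if
`q = 0`; the latter has to be decided apart, as the table would be empty. -/
def Prog.main : Prog :=
  .seq (.assign 3 (reg 1 - reg 0 + lit 1)) (.cond 3 (.assign 0 (lit 1))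
    (.cond 1 .solve (.assign 0 (lit 0))))

variable {r : ℕ → Bool} {L : ℕ} {s : State} {Q : State → Prop}

theorem len_one_le (hL : 1 ≤ L) : len 1 ≤ L := hL

theorem Tr.answer {x : ℕ} {P : Prop} (hx : x < 32) (hL : 1 ≤ L) (hP : 0 < s.reg x ↔ P) :
    Tr r L 10 (.cond x (.assign 0 (lit 1)) (.assign 0 (lit 0))) s fun s' => s'.reg 0 = 1 ↔ P := by
  refine (Tr.cond (k := 5) hx (fun h => ?_) fun h => ?_).mono (by omega) fun _ _ h => h
  · exact Tr.assign_val (v := 1) (by norm_num) (by decide) rfl (len_one_le hL) (by decide)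
      (by simpa using hP.1 h)
  · exact Tr.assign_val (v := 0) (by norm_num) (by decide) rfl (by simp [len_zero]) (by decide)
      (by simpa using mt hP.2 h)

theorem Tr.solve {n q K : ℕ} {vert : ℕ → ℕ} {adj : ℕ → ℕ → Prop} (hq : 0 < q) (hqn : q < n)
    (hvert : ∀ p < n, vert p < n) (hK : ∀ p < n, q * size (radix n adj p) p ≤ K)
    (hL : 10 * (n + 1) ^ 3 ≤ L) (hs : Encodes n q vert adj s) (hu : s.used = 0) :
    Tr r L ((2000 * ((n + 1) * (K + 1)) + 100) * n + 200) .solve s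
      fun s' => s'.reg 0 = 1 ↔ suffixCount n q adj (weight r n) n 0 ≠ 0 := by
  have hF1 : 1 ≤ stepFactor n ^ (n + 1) := Nat.one_le_pow _ _ (by
    have : 0 < n := by omega
    unfold stepFactor; positivity)
  have hFsq := stepFactor_pow_lt n L hL
  have hFL : stepFactor n ^ (n + 1) < 2 ^ L := by nlinarith
  have hL1 : 1 ≤ L := by nlinarith [Nat.one_le_pow 3 (n + 1) (by omega)]
  have hnL : n < 2 ^ L := by
    have h1 : n < L := by nlinarith [Nat.le_self_pow (n := 3) (by norm_num) (n + 1)]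
    exact h1.trans Nat.lt_two_pow_self
  set k₀ := 2000 * ((n + 1) * (K + 1)) with hk₀
  have hmul : (k₀ + 100) * n = (k₀ + 12) * n + 88 * n := by ring
  have hcost : (reg 0).cost + (reg 0).width + 2 = 5 := by decide
  rw [hmul]
  refine (Tr.seq (k₁ := 82 * n + 10) (k₂ := (k₀ + 12) * n + 150) ((Tr.fill (kb := 70)
    (F := fun _ => 1) ∅ 3 (N := n) (by norm_num) (by decide) (by decide) ?_ hnL ?_ ?_).mono ?_
    fun _ _ h => h)).mono (by omega) fun _ _ h => h
  · exact hs.order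
  · intro j _ s' _ h7 _ _
    exact Tr.put_val (a := addr 3 j) (v := 1) (by decide) (by decide) (by simp [h7]) rfl
      (fun _ => len_one_le hL1) (by decide) ⟨fun _ _ => rfl, rfl, rfl⟩
  rotate_left
  · omega
  intro s₁ hs₁
  have hs₁0 : s₁.reg 0 = n := by rw [hs₁.reg 0 (by decide), hs.order]
  refine (Tr.seq (k₁ := 40) (k₂ := (k₀ + 12) * n + 110) (Tr.put_val (a := addr 0 (0 : ℕ)) (v := 1)
    (by decide) (by decide) rfl rfl (fun _ => len_one_le hL1) (by decide) ?_)).mono (by omega)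
    fun _ _ h => h
  refine (Tr.seq (k₁ := 10) (k₂ := (k₀ + 12) * n + 100) (Tr.assign_val (v := 1) (by norm_num)
    (by decide) rfl (len_one_le hL1) (by decide) ?_)).mono (by omega) fun _ _ h => h
  refine (Tr.seq (k₁ := (k₀ + 12) * n + 10) (k₂ := 90) ((Tr.forDown (k := k₀) (N := n)
    (VertexInv r n q vert adj) (by norm_num) (by decide) ?_ hnL ?_ ?_).mono (by omega) ?_)).mono
    (by omega) fun _ _ h => h
  · simpa using hs₁0
  · refine ⟨hs.congr ?_ ?_ fun a ha => ?_, ?_, ?_, fun w hw => ?_, fun z => ?_, fun j hj => ?_⟩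
    · simp [hs₁0, hs.order]
    · simp only [State.setReg_reg, State.setMem_reg]; norm_num
      exact hs₁.reg 1 (by decide)
    · simp only [State.setReg_mem]
      rw [State.setMem_mem, if_neg (ne_addr ha 0 0), hs₁.nonneg ha]
    · simp [hs₁.used, hu]
    · simp [size_radix_self]
    · rw [State.arr_setReg, State.arr_setReg, State.arr_setMem _ (by norm_num) (by norm_num),
        if_neg (by norm_num), radix_self]
      exact hs₁.cell w hw
    · rw [tableEval_of_radix_eq_one z fun w _ => radix_self n adj w, State.arr_setReg,
        State.arr_setReg, State.arr_setMem _ (by norm_num) (by norm_num), if_pos ⟨rfl, rfl⟩,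
        Nat.sub_self]
      rfl
    · rw [size_radix_self] at hj
      obtain rfl : j = 0 := by omega
      rw [State.arr_setReg,
        State.arr_setReg, State.arr_setMem _ (by norm_num) (by norm_num), if_pos ⟨rfl, rfl⟩]
      simp
  · intro p hp s' _ _ hinv
    exact Tr.vertex hq hqn hp hvert (hK p hp) hFL (by simp)
      ⟨hinv.enc.congr (by simp) (by simp) fun _ _ => rfl, hinv.used, by simpa using hinv.total,
        hinv.radices, hinv.value, hinv.bound⟩
  · rintro s₂ hg ⟨-, hinv⟩
    have hval : s₂.arr 0 0 = suffixCount n q adj (weight r n) n 0 := by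
      simpa [tableEval] using hinv.value 0
    have hbd : |s₂.arr 0 0| ≤ (stepFactor n : ℤ) ^ n := hinv.bound 0 (by simp [size])
    refine (Tr.seq (k₁ := 80) (k₂ := 10) (Tr.assign_val (v := s₂.arr 0 0 * s₂.arr 0 0)
      (by norm_num) (by decide) rfl ?_ (by decide) ?_)).mono (by omega) fun _ _ h => h
    · rw [len_le_iff, abs_mul]
      have h1 : (stepFactor n : ℤ) ^ n ≤ stepFactor n ^ (n + 1) :=
        pow_le_pow_right₀ (by
          have : 0 < n := by omega
          have : 0 < stepFactor n := by unfold stepFactor; positivity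
          exact_mod_cast this) (by omega)
      have h2 : ((stepFactor n : ℤ) ^ (n + 1)) ^ 2 < 2 ^ L := by exact_mod_cast hFsq
      nlinarith [abs_nonneg (s₂.arr 0 0)]
    · refine Tr.answer (by norm_num) hL1 ?_
      rw [← hval]
      simp

theorem Tr.main {n q K : ℕ} {vert : ℕ → ℕ} {adj : ℕ → ℕ → Prop}
    (hvert : ∀ p < n, vert p < n) (hK : ∀ p < n, q < n → q * size (radix n adj p) p ≤ K)
    (hL : 10 * (n + 1) ^ 3 + q.size ≤ L) (hs : Encodes n q vert adj s) (hu : s.used = 0) :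
    Tr r L ((2000 * ((n + 1) * (K + 1)) + 100) * n + 300) .main s
      fun s' => s'.reg 0 = 1 ↔
        n ≤ q ∨ 0 < q ∧ suffixCount n q adj (weight r n) n 0 ≠ 0 := by
  have hL' : 10 * (n + 1) ^ 3 ≤ L := by omega
  have hn3 : 1 ≤ (n + 1) ^ 3 := Nat.one_le_pow _ _ (by omega)
  have hL1 : 1 ≤ L := by omega
  set k := (2000 * ((n + 1) * (K + 1)) + 100) * n with hk
  refine (Tr.seq (k₁ := 30) (k₂ := k + 250) (Tr.assign_val (v := (q : ℤ) - n + 1) (by norm_num)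
    (by decide) (by simp [hs.order, hs.colors]) ?_ (by decide) ?_)).mono (by omega) fun _ _ h => h
  · have h1 : (q : ℤ) < 2 ^ q.size := by exact_mod_cast Nat.lt_size_self q
    have h2 : (n : ℤ) < 2 ^ n := by exact_mod_cast Nat.lt_two_pow_self
    have h3 : (2 : ℤ) ^ q.size * 2 ^ (n + 1) ≤ 2 ^ L := by
      rw [← pow_add]
      refine pow_le_pow_right₀ (by norm_num) ?_
      nlinarith [Nat.le_self_pow (n := 3) (by norm_num) (n + 1)]
    have h4 : (1 : ℤ) ≤ 2 ^ q.size := one_le_pow₀ (by norm_num)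
    have h5 : (1 : ℤ) ≤ 2 ^ n := one_le_pow₀ (by norm_num)
    rw [pow_succ] at h3
    rw [len_le_iff, abs_lt]
    constructor <;> nlinarith
  refine (Tr.cond (k := k + 230) (by norm_num) (fun h => ?_) fun h => ?_).mono (by omega)
    fun _ _ h => h
  · have hnq : n ≤ q := by
      simp only [State.setReg_reg, if_true] at h; omega
    exact Tr.assign_val (v := 1) (by norm_num) (by decide) rfl (len_one_le hL1)
      ((by decide : _ ≤ 230).trans (Nat.le_add_left _ _)) (by simp [hnq])
  · have hqn : q < n := by
      simp only [State.setReg_reg, if_true] at h; omega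
    refine (Tr.cond (k := k + 200) (by norm_num) (fun h => ?_) fun h => ?_).mono (by omega)
      fun _ _ h => h
    · have hq : 0 < q := by simpa [hs.colors] using h
      have hs' : Encodes n q vert adj (s.setReg 3 ((q : ℤ) - n + 1)) :=
        hs.congr (by simp) (by simp) fun _ _ => rfl
      refine (Tr.solve hq hqn hvert (fun p hp => hK p hp hqn) hL' hs' hu).mono le_rfl
        fun s' _ h => h.trans ?_
      simp [hq, hqn]
    · have hq : q = 0 := by simpa [hs.colors] using h
      exact Tr.assign_val (v := 0) (by norm_num) (by decide) rfl (by simp [len_zero])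
        ((by decide : _ ≤ 200).trans (Nat.le_add_left _ _)) (by simp [hq]; omega)

end CoinRAM

namespace CutwidthColoring

open Finset

/-! ### The count as a polynomial in the weights -/

/-- A coloring of the first `p` positions as a function on all natural numbers. -/
def extend {p q : ℕ} (c : Fin p → Fin q) (v : ℕ) : ℕ := if h : v < p then c ⟨v, h⟩ else 0

theorem extend_snoc {p q : ℕ} (c : Fin p → Fin q) (a : Fin q) :
    extend (Fin.snoc (α := fun _ => Fin q) c a) = Function.update (extend c) p (a : ℕ) := by
  funext v
  unfold extend
  rcases lt_trichotomy v p with h | rfl | h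
  · rw [Function.update_of_ne h.ne, dif_pos h, dif_pos (by omega)]
    simp [Fin.snoc, h]
  · simp [Fin.snoc]
  · rw [Function.update_of_ne h.ne', dif_neg (by omega), dif_neg (by omega)]

open Classical in
/-- The product of the color differences over all edges between two of the first `p` positions. -/
noncomputable def edgeProd (adj : ℕ → ℕ → Prop) (p : ℕ) (z : ℕ → ℕ) : ℤ :=
  ∏ i ∈ range p, ∏ w ∈ range i with adj i w, ((z i : ℤ) - z w)

theorem edgeProd_congr {adj : ℕ → ℕ → Prop} {p : ℕ} {z z' : ℕ → ℕ} (h : ∀ i < p, z i = z' i) :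
    edgeProd adj p z = edgeProd adj p z' := by
  classical
  refine prod_congr rfl fun i hi => prod_congr rfl fun w hw => ?_
  have h1 := mem_range.1 hi
  have h2 := mem_range.1 (mem_filter.1 hw).1
  rw [h i h1, h w (by omega)]

/-- The count of all colorings, after the colors of the first `p` positions have been summed
explicitly. -/
theorem suffixCount_eq_sum_prefix {n : ℕ} (q : ℕ) (adj : ℕ → ℕ → Prop) (x : ℕ → ℤ) {p : ℕ}
    (hp : p ≤ n) :
    suffixCount n q adj x n 0 = ∑ c : Fin p → Fin q,
      (∏ i ∈ range p, x i ^ extend c i) * edgeProd adj p (extend c) *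
        suffixCount n q adj x (n - p) (fun v => extend c v) := by
  classical
  induction p with
  | zero =>
    have h : ∀ c : Fin 0 → Fin q, (fun v => ((extend c v : ℕ) : ℤ)) = 0 := fun c => by
      funext v; simp [extend]
    simp [h, edgeProd]
  | succ p ih =>
    rw [ih (by omega), ← (Fin.snocEquiv fun _ : Fin (p + 1) => Fin q).sum_comp,
      Fintype.sum_prod_type, sum_comm]
    refine sum_congr rfl fun c _ => ?_
    rw [suffixCount_step adj x (by omega), mul_sum, ← Fin.sum_univ_eq_sum_range
      (fun a => _ * (x p ^ a * ((∏ w ∈ range p with adj p w, ((a : ℤ) - (extend c w : ℕ))) *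
        suffixCount n q adj x (n - (p + 1)) (Function.update (fun v => ((extend c v : ℕ) : ℤ)) p a))))]
    refine sum_congr rfl fun a _ => ?_
    have h1 : (Fin.snocEquiv fun _ : Fin (p + 1) => Fin q) (a, c)
        = Fin.snoc (α := fun _ => Fin q) c a := rfl
    have h2 : (fun v => ((Function.update (extend c) p (a : ℕ) v : ℕ) : ℤ))
        = Function.update (fun v => ((extend c v : ℕ) : ℤ)) p (a : ℕ) := by
      funext v
      by_cases hv : v = p
      · subst hv; simp
      · simp [hv]
    have h3 : ∏ i ∈ range p, x i ^ Function.update (extend c) p (a : ℕ) i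
        = ∏ i ∈ range p, x i ^ extend c i :=
      prod_congr rfl fun i hi => by rw [Function.update_of_ne (mem_range.1 hi).ne]
    have h4 : edgeProd adj (p + 1) (Function.update (extend c) p (a : ℕ))
        = edgeProd adj p (extend c) * ∏ w ∈ range p with adj p w, ((a : ℤ) - (extend c w : ℕ)) := by
      rw [edgeProd, prod_range_succ]
      congr 1
      · exact edgeProd_congr fun i hi => Function.update_of_ne hi.ne _ _
      · refine prod_congr rfl fun w hw => ?_
        rw [Function.update_self, Function.update_of_ne (mem_range.1 (mem_filter.1 hw).1).ne]
    rw [h1, extend_snoc, h2, prod_range_succ, h3, h4, Function.update_self]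
    ring

theorem suffixCount_eq_sum (n q : ℕ) (adj : ℕ → ℕ → Prop) (x : ℕ → ℤ) :
    suffixCount n q adj x n 0 = ∑ c : Fin n → Fin q,
      edgeProd adj n (extend c) * ∏ i : Fin n, x i ^ (c i : ℕ) := by
  rw [suffixCount_eq_sum_prefix q adj x le_rfl]
  refine sum_congr rfl fun c _ => ?_
  rw [Nat.sub_self, suffixCount, mul_one, mul_comm, ← Fin.prod_univ_eq_prod_range]
  simp [extend]

/-- The weighted count of all colorings as a polynomial in the weights. Its coefficients are the
`edgeProd`s of the colorings, which vanish exactly if the coloring is not proper. -/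
noncomputable def countPoly (n q : ℕ) (adj : ℕ → ℕ → Prop) : MvPolynomial (Fin n) ℤ :=
  ∑ c : Fin n → Fin q, MvPolynomial.monomial (Finsupp.equivFunOnFinite.symm fun i => (c i : ℕ))
    (edgeProd adj n (extend c))

theorem eval_countPoly (n q : ℕ) (adj : ℕ → ℕ → Prop) (x : ℕ → ℤ) :
    MvPolynomial.eval (fun i : Fin n => x i) (countPoly n q adj)
      = suffixCount n q adj x n 0 := by
  rw [suffixCount_eq_sum, countPoly, map_sum]
  refine sum_congr rfl fun c _ => ?_
  rw [MvPolynomial.eval_monomial, Finsupp.prod_fintype _ _ fun i => pow_zero _]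
  rfl

theorem countPoly_ne_zero {n q : ℕ} {adj : ℕ → ℕ → Prop} {c : Fin n → Fin q}
    (hc : edgeProd adj n (extend c) ≠ 0) : countPoly n q adj ≠ 0 := by
  classical
  intro h
  have h1 := congrArg (MvPolynomial.coeff (Finsupp.equivFunOnFinite.symm fun i => (c i : ℕ))) h
  rw [countPoly, MvPolynomial.coeff_sum, sum_eq_single c] at h1
  · simp [hc] at h1
  · intro c' _ hne
    rw [MvPolynomial.coeff_monomial, if_neg]
    intro h2
    apply hne
    funext i
    have := congrFun (Finsupp.equivFunOnFinite.symm.injective h2) i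
    exact Fin.ext this
  · simp

theorem totalDegree_countPoly_le (n q : ℕ) (adj : ℕ → ℕ → Prop) :
    (countPoly n q adj).totalDegree ≤ n * q := by
  refine (MvPolynomial.totalDegree_finsetSum _ _).trans (Finset.sup_le fun c _ => ?_)
  refine (MvPolynomial.totalDegree_monomial_le _ _).trans ?_
  rw [Finsupp.sum_fintype _ _ fun _ => rfl]
  refine (sum_le_card_nsmul _ _ q fun i _ => ?_).trans (by simp)
  exact (c i).2.le

/-! ### The random weights -/

end CutwidthColoring

namespace CoinRAM

open CutwidthColoring MeasureTheory
open scoped ENNReal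

theorem bitsValue_inj {r r' : ℕ → Bool} {u k : ℕ} (h : bitsValue r u k = bitsValue r' u k) :
    ∀ i < k, r (u + i) = r' (u + i) := by
  induction k with
  | zero => intro i hi; omega
  | succ k ih =>
    rw [bitsValue, bitsValue] at h
    have h1 : bitsValue r u k = bitsValue r' u k := by split_ifs at h <;> omega
    intro i hi
    rcases Nat.lt_succ_iff_lt_or_eq.1 hi with hi | rfl
    · exact ih h1 i hi
    · rw [h1] at h
      cases hr : r (u + i) <;> cases hr' : r' (u + i) <;> simp [hr, hr'] at h ⊢

instance : IsProbabilityMeasure fairBits := by unfold fairBits; infer_instance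

theorem fairBits_prefix (r₀ : ℕ → Bool) (N : ℕ) :
    fairBits {r | ∀ i < N, r i = r₀ i} = (1 / 2) ^ N := by
  have h : {r : ℕ → Bool | ∀ i < N, r i = r₀ i}
      = Set.pi (Finset.range N) fun i => ({r₀ i} : Set Bool) := by
    ext r; simp [Set.mem_pi]
  rw [h, fairBits, Measure.infinitePi_pi _ fun _ _ => MeasurableSet.singleton _]
  simp

/-- The weights determine the first `n * (3 * n + 1)` random bits. -/
theorem fairBits_weights_le (n : ℕ) (y : Fin n → ℤ) :
    fairBits {r | ∀ p : Fin n, weight r n p = y p} ≤ (1 / 2) ^ (n * (3 * n + 1)) := by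
  rcases Set.eq_empty_or_nonempty {r | ∀ p : Fin n, weight r n p = y p} with h | ⟨r₀, hr₀⟩
  · simp [h]
  rw [← fairBits_prefix r₀]
  refine measure_mono fun r hr i hi => ?_
  have hm : 0 < 3 * n + 1 := by omega
  have hk : i / (3 * n + 1) < n := by rw [Nat.div_lt_iff_lt_mul hm]; exact hi
  have hp : n - 1 - i / (3 * n + 1) < n :=
    (Nat.sub_le _ _).trans_lt (Nat.sub_lt ((Nat.zero_le _).trans_lt hk) one_pos)
  have h1 : weight r n (n - 1 - i / (3 * n + 1)) = weight r₀ n (n - 1 - i / (3 * n + 1)) :=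
    (hr ⟨_, hp⟩).trans (hr₀ ⟨_, hp⟩).symm
  have h0 : n - (n - 1 - i / (3 * n + 1) + 1) = i / (3 * n + 1) := by
    generalize i / (3 * n + 1) = t at hk
    omega
  rw [weight, weight, h0] at h1
  have h2 := bitsValue_inj (Int.ofNat_injective h1) (i % (3 * n + 1)) (Nat.mod_lt _ hm)
  rwa [Nat.div_add_mod'] at h2

/-- If there is a proper coloring, then the weighted count vanishes with small probability. -/
theorem fairBits_count_eq_zero_le {n q : ℕ} (hqn : q < n) {adj : ℕ → ℕ → Prop} {c : Fin n → Fin q}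
    (hc : edgeProd adj n (extend c) ≠ 0) :
    fairBits {r | suffixCount n q adj (weight r n) n 0 = 0} ≤ (1 / 2) ^ (n + 1) := by
  classical
  set X : ℕ := 2 ^ (3 * n + 1) with hX
  set S : Finset ℤ := (Finset.range X).map Nat.castEmbedding with hS
  set B : Finset (Fin n → ℤ) :=
    {y ∈ Fintype.piFinset fun _ : Fin n => S | MvPolynomial.eval y (countPoly n q adj) = 0} with hB
  have hsub : {r | suffixCount n q adj (weight r n) n 0 = 0}
      ⊆ ⋃ y ∈ B, {r | ∀ p : Fin n, weight r n p = y p} := by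
    intro r hr
    refine Set.mem_biUnion (x := fun p : Fin n => weight r n p) ?_ fun _ => rfl
    rw [Finset.mem_coe, hB, Finset.mem_filter, Fintype.mem_piFinset]
    refine ⟨fun p => ?_, (eval_countPoly n q adj _).trans hr⟩
    rw [hS, Finset.mem_map]
    exact ⟨_, Finset.mem_range.2 (bitsValue_lt _ _ _), rfl⟩
  -- the Schwartz-Zippel lemma, with degree at most `n * q ≤ 4 ^ n`
  have hcard : B.card * 2 ^ (n + 1) ≤ 2 ^ (n * (3 * n + 1)) := by
    have hsz := MvPolynomial.schwartz_zippel_totalDegree (countPoly_ne_zero hc) S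
    have hSc : S.card = X := by simp [hS]
    rw [hSc] at hsz
    have hX0 : (0 : ℚ≥0) < X := by positivity
    rw [div_le_div_iff₀ (by positivity) hX0] at hsz
    have h1 : B.card * X ≤ (countPoly n q adj).totalDegree * X ^ n := by exact_mod_cast hsz
    have h2 : (countPoly n q adj).totalDegree ≤ 2 ^ n * 2 ^ n :=
      (totalDegree_countPoly_le n q adj).trans (Nat.mul_le_mul Nat.lt_two_pow_self.le
        (hqn.trans Nat.lt_two_pow_self).le)
    have h3 : X = 2 ^ (n + 1) * (2 ^ n * 2 ^ n) := by
      rw [hX, ← pow_add, ← pow_add]; congr 1; ring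
    have h4 : X ^ n = 2 ^ (n * (3 * n + 1)) := by rw [hX, ← pow_mul, mul_comm]
    rw [← h4]
    have h5 : B.card * 2 ^ (n + 1) * (2 ^ n * 2 ^ n) ≤ X ^ n * (2 ^ n * 2 ^ n) := by
      calc B.card * 2 ^ (n + 1) * (2 ^ n * 2 ^ n) = B.card * X := by rw [h3]; ring
        _ ≤ (countPoly n q adj).totalDegree * X ^ n := h1
        _ ≤ 2 ^ n * 2 ^ n * X ^ n := Nat.mul_le_mul_right _ h2
        _ = X ^ n * (2 ^ n * 2 ^ n) := by ring
    exact Nat.le_of_mul_le_mul_right h5 (by positivity)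
  have hinv : ∀ k : ℕ, (2 : ℝ≥0∞) ^ k * (1 / 2) ^ k = 1 := fun k => by
    rw [← mul_pow, one_div, ENNReal.mul_inv_cancel (by norm_num) (by norm_num), one_pow]
  calc fairBits {r | suffixCount n q adj (weight r n) n 0 = 0}
      ≤ fairBits (⋃ y ∈ B, {r | ∀ p : Fin n, weight r n p = y p}) := measure_mono hsub
    _ ≤ ∑ y ∈ B, fairBits {r | ∀ p : Fin n, weight r n p = y p} := measure_biUnion_finset_le _ _
    _ ≤ ∑ _y ∈ B, (1 / 2 : ℝ≥0∞) ^ (n * (3 * n + 1)) :=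
        Finset.sum_le_sum fun y _ => fairBits_weights_le n y
    _ = (B.card : ℝ≥0∞) * (1 / 2) ^ (n * (3 * n + 1)) := by simp
    _ = ((B.card * 2 ^ (n + 1) : ℕ) : ℝ≥0∞) * (1 / 2) ^ (n * (3 * n + 1)) * (1 / 2) ^ (n + 1) := by
        push_cast
        rw [mul_assoc (B.card : ℝ≥0∞), mul_assoc (B.card : ℝ≥0∞),
          mul_comm ((2 : ℝ≥0∞) ^ (n + 1)), mul_assoc _ ((2 : ℝ≥0∞) ^ (n + 1)), hinv, mul_one]
    _ ≤ ((2 ^ (n * (3 * n + 1)) : ℕ) : ℝ≥0∞) * (1 / 2) ^ (n * (3 * n + 1)) * (1 / 2) ^ (n + 1) := by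
        gcongr
    _ = (1 / 2) ^ (n + 1) := by push_cast; rw [hinv, one_mul]

end CoinRAM

namespace CutwidthColoring

open Finset

/-! ### Graphs with a layout -/

variable {n : ℕ}

/-- The vertex at a position. -/
def vertexAt (π : Fin n ≃ Fin n) (p : ℕ) : ℕ := if h : p < n then (π.symm ⟨p, h⟩ : ℕ) else 0

/-- The adjacency of positions. -/
def posAdj (G : SimpleGraph (Fin n)) (π : Fin n ≃ Fin n) (p w : ℕ) : Prop :=
  ∃ (hp : p < n) (hw : w < n), G.Adj (π.symm ⟨p, hp⟩) (π.symm ⟨w, hw⟩)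

theorem vertexAt_lt (π : Fin n ≃ Fin n) {p : ℕ} (hp : p < n) : vertexAt π p < n := by
  rw [vertexAt, dif_pos hp]; exact Fin.is_lt _

/-- The number of edges across a position is at most the cutwidth, and the size of the table is at
most two to this number. -/
theorem size_radix_le_two_pow (G : SimpleGraph (Fin n)) (π : Fin n ≃ Fin n) {p : ℕ} (hp : p < n) :
    size (radix n (posAdj G π) p) p ≤ 2 ^ G.layoutCutwidth π := by
  classical
  rcases Nat.eq_zero_or_pos p with rfl | hp0
  · simpa [size] using Nat.one_le_two_pow
  have h1 : size (radix n (posAdj G π) p) p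
      ≤ 2 ^ ∑ w ∈ range p, #{p' ∈ Ico p n | posAdj G π p' w} := by
    rw [← prod_pow_eq_pow_sum]
    refine prod_le_prod' fun w _ => ?_
    unfold radix
    convert Nat.succ_le_of_lt (Nat.lt_two_pow_self (n := #{p' ∈ Ico p n | posAdj G π p' w}))
  refine h1.trans (Nat.pow_le_pow_right (by norm_num) ?_)
  set cut : Set (Sym2 (Fin n)) :=
    {e ∈ G.edgeSet | ∃ u v, e = s(u, v) ∧ (π u : ℕ) < p ∧ p ≤ (π v : ℕ)} with hcut
  have h2 : cut.ncard ≤ G.layoutCutwidth π :=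
    le_sup (f := fun i => {e ∈ G.edgeSet | ∃ u v : Fin n, e = s(u, v) ∧ (π u : ℕ) < i ∧
      i ≤ (π v : ℕ)}.ncard) (mem_Ico.2 ⟨hp0, hp⟩)
  refine le_trans ?_ h2
  rw [← card_sigma]
  set T := (range p).sigma fun w => {p' ∈ Ico p n | posAdj G π p' w} with hT
  -- the vertex at a position, with an arbitrary value outside of the range
  set vtx : ℕ → Fin n := fun i => if h : i < n then π.symm ⟨i, h⟩ else ⟨p, hp⟩ with hvtx
  have hπ : ∀ i < n, (π (vtx i) : ℕ) = i := fun i hi => by simp [hvtx, hi]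
  have hmem : ∀ x ∈ T, x.1 < p ∧ p ≤ x.2 ∧ x.2 < n ∧ posAdj G π x.2 x.1 := by
    rintro ⟨w, p'⟩ hx
    simp only [hT, mem_sigma, mem_range, mem_filter, mem_Ico] at hx
    tauto
  have hinj : Set.InjOn (fun x : Σ _ : ℕ, ℕ => s(vtx x.1, vtx x.2)) T := by
    rintro ⟨w, p'⟩ hx ⟨w', p''⟩ hy hxy
    obtain ⟨a1, a2, a3, -⟩ := hmem _ hx
    obtain ⟨b1, b2, b3, -⟩ := hmem _ hy
    simp only at a1 a2 a3 b1 b2 b3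
    have e1 := hπ w (by omega)
    have e2 := hπ p' a3
    have e3 := hπ w' (by omega)
    have e4 := hπ p'' b3
    rcases Sym2.eq_iff.1 hxy with ⟨h, h'⟩ | ⟨h, h'⟩
    · simp only at h h'
      rw [h, e3] at e1
      rw [h', e4] at e2
      rw [e1, e2]
    · simp only at h
      rw [h, e4] at e1
      omega
  rw [← card_image_of_injOn hinj, ← Set.ncard_coe_finset]
  refine Set.ncard_le_ncard ?_ (Set.toFinite _)
  intro e he
  obtain ⟨⟨w, p'⟩, hx, rfl⟩ := mem_image.1 (mem_coe.1 he)
  obtain ⟨a1, a2, a3, hp', hw, hadj⟩ := hmem _ hx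
  simp only at a1 a2 a3 hp' hw hadj
  refine ⟨?_, vtx w, vtx p', rfl, ?_, ?_⟩
  · simp only [SimpleGraph.mem_edgeSet, hvtx, dif_pos hp', dif_pos hw]
    exact hadj.symm
  · rw [hπ w hw]; exact a1
  · rw [hπ p' hp']; exact a2

theorem colorable_iff_exists_edgeProd_ne_zero (G : SimpleGraph (Fin n)) (π : Fin n ≃ Fin n) (q : ℕ) :
    G.Colorable q ↔ ∃ c : Fin n → Fin q, edgeProd (posAdj G π) n (extend c) ≠ 0 := by
  classical
  constructor
  · rintro ⟨C⟩
    refine ⟨fun p => C (π.symm p), prod_ne_zero_iff.2 fun i _ => prod_ne_zero_iff.2 fun w hw => ?_⟩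
    obtain ⟨hi, hw, hadj⟩ := (mem_filter.1 hw).2
    simp only [extend, dif_pos hi, dif_pos hw]
    have := C.valid hadj
    intro h
    apply this
    have h' := sub_eq_zero.1 h
    exact Fin.ext (by exact_mod_cast h')
  · rintro ⟨c, hc⟩
    have key : ∀ u v : Fin n, G.Adj u v → (π v : ℕ) < π u → c (π u) ≠ c (π v) := by
      intro u v huv hlt h
      have h1 := prod_ne_zero_iff.1 (prod_ne_zero_iff.1 hc (π u) (mem_range.2 (π u).2)) (π v)
        (mem_filter.2 ⟨mem_range.2 hlt, (π u).2, (π v).2, by simpa using huv⟩)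
      apply h1
      simp [extend, h]
    refine ⟨SimpleGraph.Coloring.mk (fun v => c (π v)) fun {u v} huv => ?_⟩
    have hne : (π u : ℕ) ≠ π v := fun h => huv.ne (π.injective (Fin.ext h))
    rcases Nat.lt_or_gt_of_ne hne with h | h
    · exact (key v u huv.symm h).symm
    · exact key u v huv h

/-- A nonzero weighted count certifies a proper coloring. -/
theorem colorable_of_count_ne_zero {G : SimpleGraph (Fin n)} {π : Fin n ≃ Fin n} {q : ℕ} {x : ℕ → ℤ}
    (h : suffixCount n q (posAdj G π) x n 0 ≠ 0) : G.Colorable q := by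
  rw [suffixCount_eq_sum] at h
  obtain ⟨c, -, hc⟩ := exists_ne_zero_of_sum_ne_zero h
  exact (colorable_iff_exists_edgeProd_ne_zero G π q).2 ⟨c, left_ne_zero_of_mul hc⟩

end CutwidthColoring

namespace CoinRAM

open CutwidthColoring

variable {n : ℕ} (G : SimpleGraph (Fin n)) (π : Fin n ≃ Fin n) (q : ℕ)

theorem encodes_input : Encodes n q (vertexAt π) (posAdj G π) (input G π q) := by
  refine ⟨by simp [input], by simp [input], fun p hp => ?_, fun p hp w hw => ?_⟩
  · have h : (0 : ℤ) ≤ p ∧ (p : ℤ) < n := ⟨by positivity, by exact_mod_cast hp⟩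
    simp only [input, dif_pos h, vertexAt, dif_pos hp, Int.toNat_natCast]
  · have hu := vertexAt_lt π hp
    have hv := vertexAt_lt π hw
    have h : ¬ ((0 : ℤ) ≤ n + n * vertexAt π p + vertexAt π w ∧
        (n : ℤ) + n * vertexAt π p + vertexAt π w < n) := by
      rintro ⟨-, h⟩
      have : (0 : ℤ) ≤ n * vertexAt π p + vertexAt π w := by positivity
      linarith
    simp only [input, dif_neg h]
    congr 1
    refine propext ⟨?_, ?_⟩
    · rintro ⟨a, b, hab, heq⟩
      have heq' : n * vertexAt π p + vertexAt π w = n * a + b := by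
        have : ((n * vertexAt π p + vertexAt π w : ℕ) : ℤ) = ((n * a + b : ℕ) : ℤ) := by
          push_cast; linarith
        exact_mod_cast this
      have hn : 0 < n := by omega
      have h1 : vertexAt π p = a := by
        have := congrArg (· / n) heq'
        simpa [Nat.mul_add_div hn, Nat.div_eq_of_lt hv, Nat.div_eq_of_lt b.2] using this
      have h2 : vertexAt π w = b := by rw [h1] at heq'; omega
      refine ⟨hp, hw, ?_⟩
      rw [vertexAt, dif_pos hp] at h1
      rw [vertexAt, dif_pos hw] at h2
      rwa [Fin.ext h1, Fin.ext h2]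
    · rintro ⟨hp, hw, hadj⟩
      refine ⟨_, _, hadj, ?_⟩
      simp [vertexAt, hp, hw]

theorem good_input {L : ℕ} (hL : n + q.size < L) : (input G π q).Good L := by
  have h2L : ∀ a : ℕ, a ≤ n → len (a : ℤ) ≤ L := fun a ha =>
    len_natCast_le ((ha.trans_lt (by omega)).trans Nat.lt_two_pow_self)
  refine ⟨fun x hx => ?_, fun x _ => ?_, fun a => ?_⟩
  · simp [input, show x ≠ 0 by omega, show x ≠ 1 by omega]
  · simp only [input]
    split_ifs
    · exact h2L n le_rfl
    · exact (show q.size ≤ L by omega)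
    · simp [len_zero]
  · simp only [input]
    split_ifs
    · exact h2L _ (Fin.is_lt _).le
    · exact len_one_le (by omega)
    · simp [len_zero]

/-- The time of `main` in the form required, with `m` for the length of `q` and `C` for two to the
cutwidth. -/
theorem time_bound (n m C : ℕ) (hC : 1 ≤ C) :
    ((2000 * ((n + 1) * (n * C + 1)) + 100) * n + 300) * (10 * (n + 1) ^ 3 + m + 1)
      ≤ 26400 * C * (n + m + 1) ^ 6 := by
  set N := n + m + 1 with hN
  have hN1 : 1 ≤ N := by omega
  have hn : n + 1 ≤ N := by omega
  have hN3 : N ≤ N ^ 3 := Nat.le_self_pow (by norm_num) N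
  have h1 : (n + 1) ^ 3 ≤ N ^ 3 := Nat.pow_le_pow_left hn 3
  have h2 : 10 * (n + 1) ^ 3 + m + 1 ≤ 11 * N ^ 3 := by omega
  have h3 : n * C + 1 ≤ (n + 1) * C := by rw [add_mul]; omega
  have h4 : (2000 * ((n + 1) * (n * C + 1)) + 100) * n + 300 ≤ 2400 * C * N ^ 3 := by
    calc (2000 * ((n + 1) * (n * C + 1)) + 100) * n + 300
        ≤ (2000 * ((n + 1) * ((n + 1) * C)) + 100) * (n + 1) + 300 := by gcongr; omega
      _ = 2000 * (C * (n + 1) ^ 3) + 100 * (n + 1) + 300 := by ring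
      _ ≤ 2000 * (C * N ^ 3) + 100 * (C * N ^ 3) + 300 * (C * N ^ 3) := by
        have h5 : N ^ 3 ≤ C * N ^ 3 := Nat.le_mul_of_pos_left _ hC
        have h6 : C * (n + 1) ^ 3 ≤ C * N ^ 3 := Nat.mul_le_mul_left _ h1
        omega
      _ = 2400 * C * N ^ 3 := by ring
  calc _ ≤ 2400 * C * N ^ 3 * (11 * N ^ 3) := Nat.mul_le_mul h4 h2
    _ = 26400 * C * N ^ 6 := by ring

theorem exec_main (r : ℕ → Bool) :
    ∃ s' t, Exec r .main (input G π q) s' t ∧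
      t ≤ 26400 * 2 ^ G.layoutCutwidth π * (n + q.size + 1) ^ 6 ∧
      (s'.reg 0 = 1 ↔ n ≤ q ∨ 0 < q ∧ suffixCount n q (posAdj G π) (weight r n) n 0 ≠ 0) := by
  have hn3 : n + 1 ≤ (n + 1) ^ 3 := Nat.le_self_pow (by norm_num) _
  obtain ⟨s', t, he, ht, -, hQ⟩ := Tr.main (r := r) (n := n) (q := q)
    (K := n * 2 ^ G.layoutCutwidth π) (L := 10 * (n + 1) ^ 3 + q.size)
    (fun p hp => vertexAt_lt π hp)
    (fun p hp hqn => Nat.mul_le_mul hqn.le (size_radix_le_two_pow G π hp)) le_rfl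
    (encodes_input G π q) rfl (good_input G π q (by omega))
  exact ⟨s', t, he, ht.trans (time_bound n q.size _ Nat.one_le_two_pow), hQ⟩

end CoinRAM

open CutwidthColoring

/-- One randomized program decides, for every number of colors `q` and every graph `G` with a given
linear layout `π`, whether `G` is `q`-colorable, in time `2 ^ ctw` times a polynomial in the input
size `n + log q`, whatever the random bits are; "yes" is never wrong, and "no" is wrong with
probability at most `2 ^ (-(n + 1))`. -/
theorem theorem2 :
    ∃ (P : CoinRAM.Prog) (c d : ℕ),
      ∀ (n q : ℕ) (G : SimpleGraph (Fin n)) (π : Fin n ≃ Fin n),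
        (∀ r : ℕ → Bool, CoinRAM.HaltsWithin r P (CoinRAM.input G π q)
          (c * 2 ^ G.layoutCutwidth π * (n + q.size + 1) ^ d)) ∧
        (¬ G.Colorable q → ∀ r : ℕ → Bool, CoinRAM.AnswersNo r P (CoinRAM.input G π q)) ∧
        (G.Colorable q →
          1 - (1 / 2) ^ (n + 1) ≤
            CoinRAM.fairBits {r | CoinRAM.AnswersYes r P (CoinRAM.input G π q)}) := by
  refine ⟨CoinRAM.Prog.main, 26400, 6, fun n q G π => ⟨fun r => ?_, fun hcol r => ?_, fun hcol => ?_⟩⟩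
  · obtain ⟨s', t, he, ht, -⟩ := CoinRAM.exec_main G π q r
    exact ⟨s', t, he, ht⟩
  · obtain ⟨s', t, he, -, hyes⟩ := CoinRAM.exec_main G π q r
    refine ⟨s', t, he, fun h => hcol ?_⟩
    rcases hyes.1 h with hnq | ⟨-, hne⟩
    · exact G.colorable_of_fintype.mono (by simpa using hnq)
    · exact colorable_of_count_ne_zero hne
  · have hsub : {r | ¬ (n ≤ q ∨
        0 < q ∧ suffixCount n q (posAdj G π) (CoinRAM.weight r n) n 0 ≠ 0)}ᶜ
        ⊆ {r | CoinRAM.AnswersYes r .main (CoinRAM.input G π q)} := by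
      intro r hr
      obtain ⟨s', t, he, -, hyes⟩ := CoinRAM.exec_main G π q r
      exact ⟨s', t, he, hyes.2 (not_not.1 hr)⟩
    have hbad : CoinRAM.fairBits {r | ¬ (n ≤ q ∨
        0 < q ∧ suffixCount n q (posAdj G π) (CoinRAM.weight r n) n 0 ≠ 0)} ≤ (1 / 2) ^ (n + 1) := by
      rcases Nat.lt_or_ge q n with hqn | hqn
      · obtain ⟨c, hc⟩ := (colorable_iff_exists_edgeProd_ne_zero G π q).1 hcol
        refine (MeasureTheory.measure_mono fun r hr => ?_).trans
          (CoinRAM.fairBits_count_eq_zero_le hqn hc)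
        have hq : 0 < q := (Fin.pos (c ⟨0, by omega⟩))
        by_contra h
        exact hr (Or.inr ⟨hq, h⟩)
      · simp [hqn]
    refine le_trans ?_ (MeasureTheory.measure_mono hsub)
    refine le_trans (tsub_le_tsub_left hbad 1) ?_
    rw [← MeasureTheory.measure_univ (μ := CoinRAM.fairBits)]
    exact MeasureTheory.le_measure_sdiff.trans (MeasureTheory.measure_mono fun r hr => hr.2)
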